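/- All graphs are finite and simple and have at least one vertex. For a graph $G$, write $d(G)=2|E(G)|/|V(G)|$ for its average degree and $\tau(G)$ for its biclique number, i.e. the largest integer $s\ge 0$ such that $G$ contains a (not necessarily induced) copy of the complete bipartite graph $K_{s,s}$. A class $\mathcal{F}$ of graphs is hereditary if every induced subgraph of every $G\in\mathcal{F}$ is also in $\mathcal{F}$. A function $g:\mathbb{N}\to\mathbb{N}$ is a degree-bounding function for $\mathcal{F}$ if $d(G)\le g(\tau(G))$ for every $G\in\mathcal{F}$, and a hereditary class $\mathcal{F}$ is degree-bounded if it has a degree-bounding function. Corollary 1.4. For every hereditary degree-bounded class of graphs $\mathcal{F}$ there is a constant $C=C_{\mathcal{F}}\in\mathbb{N}$ such that $s\mapsto C^{s^3}$ is a degree-bounding function for $\mathcal{F}$, that is, $d(G)\le C^{\tau(G)^3}$ for every $G\in\mathcal{F}$. Moreover, with the same $C$, for every $s\in\mathbb{N}$, every $G\in\mathcal{F}$ that contains no copy of $K_{s,s}$ satisfies $d(G)<C^{s^3}$. -/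

import Mathlib

universe u

/-- A finite simple graph with at least one vertex (so that its average degree makes sense). -/
structure FinGraph where
  V : Type u
  [finite : Finite V]
  [nonempty : Nonempty V]
  graph : SimpleGraph V

attribute [instance] FinGraph.finite FinGraph.nonempty

namespace FinGraph

/-- The subgraph of `G` induced on the nonempty vertex set `S`. -/
def induce (G : FinGraph.{u}) (S : Set G.V) (hS : S.Nonempty) : FinGraph.{u} :=
  haveI : Nonempty S := hS.to_subtype
  { V := S, graph := G.graph.induce S }

/-- The average degree `d(G) = 2 e(G) / |G|`. -/
noncomputable def averageDegree (G : FinGraph.{u}) : ℝ :=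
  2 * (G.graph.edgeSet.ncard : ℝ) / (Nat.card G.V : ℝ)

/-- `G` contains a (not necessarily induced) copy of the balanced complete bipartite graph
`K_{s,s}`. -/
def ContainsBiclique (G : FinGraph.{u}) (s : ℕ) : Prop :=
  (completeBipartiteGraph (Fin s) (Fin s)).IsContained G.graph

/-- The biclique number `τ(G)`: the largest `s` such that `G` contains a copy of `K_{s,s}`. -/
noncomputable def bicliqueNumber (G : FinGraph.{u}) : ℕ :=
  sSup {s : ℕ | G.ContainsBiclique s}

/-- The maximum in the definition of the biclique number is attained. -/
theorem isGreatest_bicliqueNumber (G : FinGraph.{u}) :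
    IsGreatest {s : ℕ | G.ContainsBiclique s} G.bicliqueNumber := by
  have hne : {s : ℕ | G.ContainsBiclique s}.Nonempty :=
    ⟨0, ⟨⟨⟨fun x => isEmptyElim x, fun {a} => isEmptyElim a⟩, fun a => isEmptyElim a⟩⟩⟩
  have hbdd : BddAbove {s : ℕ | G.ContainsBiclique s} := by
    refine ⟨Nat.card G.V, ?_⟩
    rintro s ⟨f⟩
    have h := Nat.card_le_card_of_injective _ f.injective
    simp only [Nat.card_sum, Nat.card_fin] at h
    omega
  exact ⟨Nat.sSup_mem hne hbdd, fun s hs => le_csSup hbdd hs⟩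

/-- A family of graphs is hereditary if it contains every induced subgraph of each of its
members. -/
def IsHereditary (F : Set FinGraph.{u}) : Prop :=
  ∀ G ∈ F, ∀ (S : Set G.V) (hS : S.Nonempty), G.induce S hS ∈ F

/-- `g` is a degree-bounding function for `F`: `d(G) ≤ g(τ(G))` for every `G` in `F`. -/
def IsDegreeBoundingFunction (F : Set FinGraph.{u}) (g : ℕ → ℕ) : Prop :=
  ∀ G ∈ F, G.averageDegree ≤ (g G.bicliqueNumber : ℝ)

/-- A family of graphs is degree-bounded if it has a degree-bounding function. -/
def IsDegreeBounded (F : Set FinGraph.{u}) : Prop :=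
  ∃ g : ℕ → ℕ, IsDegreeBoundingFunction F g

end FinGraph

/-! A four-cycle-free graph has biclique number at most 1, so its average degree in the class is at
most `max (g 0) (g 1)`. It therefore suffices to find, in every K_{s,s}-free graph of average degree
at least C^{s^3}, an induced four-cycle-free subgraph of average degree at least a fixed k exceeding
both values.

Restrict to a vertex set of maximum density, about q; all its subsets are then sparse on the scale
q. If the vertices of degree below qL still span a constant share of the edges, Kővári–Sós–Turán
makes four-cycles so rare that a random subset of density of order 1/q, with a vertex of each
four-cycle deleted, works (`hasSparseDense_of_maxDegree`). Otherwise there is a bipartite pair (A,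
B) with B far smaller than A and with of order q neighbours in B for each vertex of A.

For such a pair (`DensePair.step`), suppose first that pairs of high codegree are rare inside
neighbourhoods. Sample with probability 1/q: with probability independent of q, a vertex of A sees
exactly k sampled vertices of B, with pairwise low codegrees. The conflicts between such vertices of
A are sparse, and a conflict-free set of them outnumbers the sampled part of B
(`hasSparseDense_of_clean`). In the other case some u in B allows A to shrink into the neighbourhood
of u, and B to the vertices of high codegree with u, at a bounded loss. After s such steps a K_{s,s}
appears.

The sampling loss is exponential in s, it is paid s times in the imbalance L, and Kővári–Sós–Turán
raises the result to the power s: hence s^3. -/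

namespace DegreeBounded

open scoped Classical
open Finset

variable {V : Type*}

/-! ### Counting adjacent pairs -/

/-- The neighbours of `x` inside `Y`. -/
noncomputable def nbr (G : SimpleGraph V) (x : V) (Y : Finset V) : Finset V := {y ∈ Y | G.Adj x y}

/-- The number of pairs in `X × Y` that are adjacent in `G`. -/
noncomputable def adjCount (G : SimpleGraph V) (X Y : Finset V) : ℕ := ∑ x ∈ X, #(nbr G x Y)

/-- `G` has no (not necessarily induced) complete bipartite subgraph with parts of size `s`. -/
def BicliqueFree (G : SimpleGraph V) (s : ℕ) : Prop :=
  ∀ X Y : Finset V, #X = s → #Y = s → ∃ x ∈ X, ∃ y ∈ Y, ¬ G.Adj x y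

/-- No four vertices of `S` carry a cycle of length four. -/
def FourCycleFree (G : SimpleGraph V) (S : Finset V) : Prop :=
  ∀ x ∈ S, ∀ y ∈ S, ∀ z ∈ S, ∀ w ∈ S, G.Adj x y → G.Adj y z → G.Adj z w → G.Adj w x →
    x = z ∨ y = w

/-- `G` has a nonempty induced subgraph without four-cycles of average degree at least `k`. -/
def HasSparseDense (G : SimpleGraph V) (k : ℕ) : Prop :=
  ∃ S : Finset V, S.Nonempty ∧ FourCycleFree G S ∧ k * #S ≤ adjCount G S S

variable {G : SimpleGraph V}

@[simp] lemma mem_nbr {x y : V} {Y : Finset V} : y ∈ nbr G x Y ↔ y ∈ Y ∧ G.Adj x y := by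
  simp [nbr]

lemma nbr_subset (x : V) (Y : Finset V) : nbr G x Y ⊆ Y := filter_subset _ _

lemma nbr_mono (x : V) {Y Y' : Finset V} (h : Y ⊆ Y') : nbr G x Y ⊆ nbr G x Y' :=
  filter_subset_filter _ h

lemma adjCount_comm (X Y : Finset V) : adjCount G X Y = adjCount G Y X := by
  refine (sum_card_bipartiteAbove_eq_sum_card_bipartiteBelow (fun x y => G.Adj x y)).trans ?_
  simp only [adjCount, nbr, bipartiteBelow, G.adj_comm]

lemma adjCount_mono {X X' Y Y' : Finset V} (hX : X ⊆ X') (hY : Y ⊆ Y') :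
    adjCount G X Y ≤ adjCount G X' Y' :=
  (sum_le_sum fun x _ => card_le_card (nbr_mono x hY)).trans
    (sum_le_sum_of_subset hX)

lemma adjCount_union_left {X X' : Finset V} (h : Disjoint X X') (Y : Finset V) :
    adjCount G (X ∪ X') Y = adjCount G X Y + adjCount G X' Y :=
  sum_union h

lemma adjCount_union_right (X : Finset V) {Y Y' : Finset V} (h : Disjoint Y Y') :
    adjCount G X (Y ∪ Y') = adjCount G X Y + adjCount G X Y' := by
  rw [adjCount_comm, adjCount_union_left h, adjCount_comm Y, adjCount_comm Y']

lemma adjCount_union_self {X Y : Finset V} (h : Disjoint X Y) :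
    adjCount G (X ∪ Y) (X ∪ Y) = adjCount G X X + 2 * adjCount G X Y + adjCount G Y Y := by
  rw [adjCount_union_left h, adjCount_union_right X h, adjCount_union_right Y h,
    adjCount_comm Y X]
  ring

lemma adjCount_le_card_mul (X Y : Finset V) : adjCount G X Y ≤ #X * #Y :=
  sum_le_card_nsmul _ _ _ fun x _ => card_le_card (nbr_subset x Y)

/-! ### Union bounds over tuples and the Kővári–Sós–Turán theorem -/

/-- The number of tuples two given entries of which are related. -/
lemma card_tuples_rel {α : Type*} (k : ℕ) (X : Finset α) (R : α → α → Prop) {i j : Fin k}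
    (hij : i ≠ j) :
    #{f ∈ Fintype.piFinset fun _ : Fin k => X | R (f i) (f j)} =
      (∑ x ∈ X, #{y ∈ X | R x y}) * #X ^ (k - 2) := by
  have h1 : #{f ∈ Fintype.piFinset fun _ : Fin k => X | R (f i) (f j)} =
      ∑ x ∈ X, #(Fintype.piFinset fun l : Fin k =>
        if l = i then {x} else if l = j then {y ∈ X | R x y} else X) := by
    rw [← card_sigma, ← card_image_of_injOn (f := fun f : Fin k → α => (⟨f i, f⟩ : Σ _ : α, _))]
    · congr 1
      ext ⟨x, f⟩
      simp only [mem_image, mem_filter, Fintype.mem_piFinset, mem_sigma, Sigma.mk.injEq, heq_eq_eq]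
      constructor
      · rintro ⟨g, ⟨hg, hR⟩, rfl, rfl⟩
        refine ⟨hg i, fun l => ?_⟩
        split_ifs with h h'
        · simp [h]
        · subst h'; simp [hg, hR]
        · exact hg l
      · rintro ⟨hx, hf⟩
        have hi : f i = x := by simpa using hf i
        have hj : f j ∈ X ∧ R x (f j) := by simpa [hij.symm] using hf j
        refine ⟨f, ⟨fun l => ?_, hi ▸ hj.2⟩, hi, rfl⟩
        by_cases h : l = i
        · rw [h, hi]; exact hx
        · by_cases h' : l = j
          · rw [h']; exact hj.1
          · simpa [h, h'] using hf l
    · intro f _ g _ h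
      simpa using (Sigma.mk.inj h).2
  rw [h1, sum_mul]
  refine sum_congr rfl fun x _ => ?_
  rw [Fintype.card_piFinset, ← mul_prod_erase univ _ (mem_univ i),
    ← mul_prod_erase (univ.erase i) _ (mem_erase.2 ⟨hij.symm, mem_univ j⟩)]
  rw [prod_congr rfl (g := fun _ => #X)]
  · simp only [if_true, card_singleton, one_mul, if_neg hij.symm, prod_const]
    congr 2
    rw [card_erase_of_mem (mem_erase.2 ⟨hij.symm, mem_univ j⟩), card_erase_of_mem (mem_univ i),
      card_univ, Fintype.card_fin]
    omega
  · intro l hl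
    simp only [mem_erase] at hl
    simp [hl.1, hl.2.1]

/-- A union bound for tuples with some pair of entries related. -/
lemma card_tuples_exists_rel_le {α : Type*} (k : ℕ) (X : Finset α) (R : α → α → Prop) :
    #{f ∈ Fintype.piFinset fun _ : Fin k => X | ∃ i j, i ≠ j ∧ R (f i) (f j)} ≤
      k * (k - 1) * ((∑ x ∈ X, #{y ∈ X | R x y}) * #X ^ (k - 2)) := by
  have hsub : ({f ∈ Fintype.piFinset fun _ : Fin k => X | ∃ i j, i ≠ j ∧ R (f i) (f j)}) ⊆
      (univ.offDiag : Finset (Fin k × Fin k)).biUnion fun ij =>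
        {f ∈ Fintype.piFinset fun _ : Fin k => X | R (f ij.1) (f ij.2)} := by
    intro f hf
    simp only [mem_filter] at hf
    obtain ⟨hX, i, j, hij, hR⟩ := hf
    simp only [mem_biUnion, mem_filter]
    exact ⟨(i, j), by simp [hij], hX, hR⟩
  refine (card_le_card hsub).trans (card_biUnion_le.trans ?_)
  rw [sum_congr rfl fun ij hij => card_tuples_rel k X R (mem_offDiag.1 hij).2.2]
  rw [sum_const, offDiag_card, card_univ, Fintype.card_fin, smul_eq_mul, Nat.mul_sub_one]

/-- The Kővári–Sós–Turán bound, in a form without roots. -/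
lemma adjCount_pow_le {s m : ℕ} (hs : 1 ≤ s) (hG : BicliqueFree G s) {X Y : Finset V}
    (hX : #X ≤ m) (hY : #Y ≤ m) : adjCount G X Y ^ s ≤ s ^ 2 * m ^ (2 * s - 1) := by
  obtain ⟨t, rfl⟩ : ∃ t, s = t + 1 := ⟨s - 1, by omega⟩
  -- The power mean inequality passes from edges to stars centred in `Y` with `t + 1` ordered leaves
  -- in `X`; double counting then groups the stars by their leaves.
  have hpow : adjCount G X Y ^ (t + 1) ≤ #Y ^ t * ∑ y ∈ Y, #(nbr G y X) ^ (t + 1) := by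
    rw [adjCount_comm]
    exact pow_sum_le_card_mul_sum_pow (fun _ _ => Nat.zero_le _) t
  have hcount : ∑ y ∈ Y, #(nbr G y X) ^ (t + 1) =
      ∑ f ∈ Fintype.piFinset fun _ : Fin (t + 1) => X, #{y ∈ Y | ∀ i, G.Adj y (f i)} := by
    have := sum_card_bipartiteAbove_eq_sum_card_bipartiteBelow
      (s := Y) (t := Fintype.piFinset fun _ : Fin (t + 1) => X) (fun y f => ∀ i, G.Adj y (f i))
    refine Eq.trans (sum_congr rfl fun y _ => ?_) this
    rw [show bipartiteAbove _ _ y = Fintype.piFinset fun _ : Fin (t + 1) => nbr G y X from ?_]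
    · simp [Fintype.card_piFinset]
    · ext f
      simp [bipartiteAbove, Fintype.mem_piFinset, forall_and]
  have hbound : ∑ f ∈ Fintype.piFinset fun _ : Fin (t + 1) => X, #{y ∈ Y | ∀ i, G.Adj y (f i)} ≤
      (t + 1) ^ 2 * m ^ (t + 1) := by
    -- Distinct leaves have at most `t` common neighbours, or a biclique would appear; tuples with a
    -- repeated leaf are few and get the trivial bound `m`.
    have h1 : ∀ f ∈ Fintype.piFinset fun _ : Fin (t + 1) => X,
        #{y ∈ Y | ∀ i, G.Adj y (f i)} ≤ t + if ∃ i j, i ≠ j ∧ f i = f j then m else 0 := by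
      intro f hf
      split_ifs with h
      · exact ((card_filter_le _ _).trans hY).trans (Nat.le_add_left _ _)
      · by_contra! hcon
        have hinj : Function.Injective f := by
          intro i j hfij
          by_contra hne
          exact h ⟨i, j, hne, hfij⟩
        obtain ⟨Y', hY', hcard⟩ := exists_subset_card_eq
          (show t + 1 ≤ #{y ∈ Y | ∀ i, G.Adj y (f i)} by omega)
        obtain ⟨x, hx, y, hy, hxy⟩ := hG (univ.image f) Y'
          (by rw [card_image_of_injective _ hinj]; simp) hcard
        obtain ⟨i, -, rfl⟩ := mem_image.1 hx
        exact hxy ((mem_filter.1 (hY' hy)).2 i).symm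
    refine (sum_le_sum h1).trans ?_
    rw [sum_add_distrib, sum_const, ← sum_filter, sum_const, Fintype.card_piFinset]
    simp only [prod_const, card_univ, Fintype.card_fin, smul_eq_mul]
    have h2 := card_tuples_exists_rel_le (t + 1) X (fun x y => x = y)
    have h3 : ∑ x ∈ X, #{y ∈ X | x = y} = #X := by
      rw [card_eq_sum_ones]
      refine sum_congr rfl fun x hx => ?_
      rw [filter_eq, if_pos hx, card_singleton]
    rw [h3] at h2
    rcases Nat.eq_zero_or_pos t with rfl | ht
    · simp only [zero_add, Nat.sub_self, mul_zero, zero_mul, Nat.le_zero] at h2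
      simp
    · have h4 : #X * #X ^ (t + 1 - 2) = #X ^ t := by
        rw [← pow_succ']; congr 1; omega
      rw [h4] at h2
      calc #X ^ (t + 1) * t + _ * m ≤ m ^ (t + 1) * t + ((t + 1) * (t + 1 - 1) * m ^ t) * m := by
            gcongr
            exact h2.trans (by gcongr)
        _ = (t * (t + 2)) * m ^ (t + 1) := by rw [Nat.add_sub_cancel]; ring
        _ ≤ _ := by gcongr; nlinarith
  calc _ ≤ #Y ^ t * ∑ y ∈ Y, #(nbr G y X) ^ (t + 1) := hpow
    _ ≤ m ^ t * ((t + 1) ^ 2 * m ^ (t + 1)) := by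
        gcongr
        rw [hcount]; exact hbound
    _ = (t + 1) ^ 2 * m ^ (2 * (t + 1) - 1) := by
        rw [show 2 * (t + 1) - 1 = t + (t + 1) by omega, pow_add]; ring

lemma adjCount_mul_le {s m Z : ℕ} (hs : 1 ≤ s) (hG : BicliqueFree G s) {X Y : Finset V}
    (hX : #X ≤ m) (hY : #Y ≤ m) (hZ : Z ^ s * s ^ 2 ≤ m) : adjCount G X Y * Z ≤ m ^ 2 := by
  have h := adjCount_pow_le hs hG hX hY
  refine le_of_pow_le_pow_left₀ (n := s) (by omega) (Nat.zero_le _) ?_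
  calc (adjCount G X Y * Z) ^ s = adjCount G X Y ^ s * Z ^ s := mul_pow ..
    _ ≤ s ^ 2 * m ^ (2 * s - 1) * Z ^ s := by gcongr
    _ = (Z ^ s * s ^ 2) * m ^ (2 * s - 1) := by ring
    _ ≤ m * m ^ (2 * s - 1) := by gcongr
    _ = (m ^ 2) ^ s := by rw [← pow_succ', ← pow_mul]; congr 1; omega

lemma adjCount_le_sdiff_add {R Y : Finset V} (h : R ⊆ Y) :
    adjCount G Y Y ≤ adjCount G (Y \ R) (Y \ R) + 2 * adjCount G R Y := by
  have h1 := adjCount_union_self (G := G) (disjoint_sdiff (s := R) (t := Y))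
  have h2 := adjCount_union_right (G := G) R (disjoint_sdiff (s := R) (t := Y))
  rw [union_sdiff_of_subset h] at h1 h2
  omega

/-! ### Random subsets -/

/-- The weight of `S` when each element is chosen independently with probability `p`. -/
noncomputable def weight [Fintype V] (p : ℝ) (S : Finset V) : ℝ := p ^ #S * (1 - p) ^ #Sᶜ

/-- The expected value of `f` at a random subset, elements being chosen with probability `p`. -/
noncomputable def expect [Fintype V] (p : ℝ) (f : Finset V → ℝ) : ℝ := ∑ S, weight p S * f S

/-- The indicator function of the event that the random set contains `T` and misses `W`. -/
noncomputable def hit (T W S : Finset V) : ℝ := if T ⊆ S ∧ Disjoint W S then 1 else 0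

lemma hit_nonneg (T W S : Finset V) : 0 ≤ hit T W S := by
  unfold hit; split_ifs <;> simp

lemma card_inter_eq_sum_hit (X S : Finset V) : (#(X ∩ S) : ℝ) = ∑ x ∈ X, hit {x} ∅ S := by
  simp only [hit, singleton_subset_iff, disjoint_empty_left, and_true, sum_boole,
    filter_mem_eq_inter]

lemma nbr_inter (x : V) (U S : Finset V) : nbr G x (U ∩ S) = nbr G x U ∩ S := by
  ext; simp; tauto

lemma adjCount_inter_eq_sum_hit (U S : Finset V) :
    (adjCount G (U ∩ S) (U ∩ S) : ℝ) = ∑ x ∈ U, ∑ y ∈ nbr G x U, hit {x, y} ∅ S := by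
  rw [adjCount, ← filter_mem_eq_inter (s := U), sum_filter, Nat.cast_sum]
  refine sum_congr rfl fun x _ => ?_
  split_ifs with hx
  · rw [filter_mem_eq_inter, nbr_inter, card_inter_eq_sum_hit]
    exact sum_congr rfl fun y _ => by simp [hit, insert_subset_iff, hx]
  · simp [hit, insert_subset_iff, hx]

section Expect

variable [Fintype V] {p : ℝ}

lemma expect_add (f g : Finset V → ℝ) :
    expect p (fun S => f S + g S) = expect p f + expect p g := by
  simp [expect, mul_add, sum_add_distrib]

lemma expect_sub (f g : Finset V → ℝ) :
    expect p (fun S => f S - g S) = expect p f - expect p g := by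
  simp [expect, mul_sub, sum_sub_distrib]

lemma expect_const_mul (c : ℝ) (f : Finset V → ℝ) :
    expect p (fun S => c * f S) = c * expect p f := by
  simp only [expect, mul_sum]
  exact sum_congr rfl fun S _ => by ring

lemma expect_sum {ι : Type*} (I : Finset ι) (f : ι → Finset V → ℝ) :
    expect p (fun S => ∑ i ∈ I, f i S) = ∑ i ∈ I, expect p (f i) := by
  simp only [expect, mul_sum]
  exact sum_comm

lemma weight_nonneg (h0 : 0 ≤ p) (h1 : p ≤ 1) (S : Finset V) : 0 ≤ weight p S :=
  mul_nonneg (pow_nonneg h0 _) (pow_nonneg (sub_nonneg.2 h1) _)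

lemma expect_mono (h0 : 0 ≤ p) (h1 : p ≤ 1) {f g : Finset V → ℝ} (h : ∀ S, f S ≤ g S) :
    expect p f ≤ expect p g :=
  sum_le_sum fun S _ => mul_le_mul_of_nonneg_left (h S) (weight_nonneg h0 h1 S)

lemma exists_pos_of_expect_pos (h0 : 0 ≤ p) (h1 : p ≤ 1) {f : Finset V → ℝ}
    (h : 0 < expect p f) : ∃ S, 0 < f S := by
  by_contra! hcon
  refine absurd h (not_lt.2 (sum_nonpos fun S _ => ?_))
  exact mul_nonpos_of_nonneg_of_nonpos (weight_nonneg h0 h1 S) (hcon S)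

lemma expect_hit {T W : Finset V} (h : Disjoint T W) :
    expect p (hit T W) = p ^ #T * (1 - p) ^ #W := by
  -- Expanding the product over all vertices gives one term for each `S`; the zeros remove exactly
  -- the sets that meet `W` or fail to contain `T`.
  have key := prod_add (fun i => if i ∈ W then 0 else p) (fun i => if i ∈ T then 0 else 1 - p)
    (univ : Finset V)
  have hl : ∏ i : V, ((if i ∈ W then 0 else p) + (if i ∈ T then 0 else 1 - p)) =
      p ^ #T * (1 - p) ^ #W := by
    have : ∀ i : V, ((if i ∈ W then 0 else p) + (if i ∈ T then 0 else 1 - p)) =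
        (if i ∈ T then p else 1) * (if i ∈ W then 1 - p else 1) := by
      intro i
      by_cases hT : i ∈ T
      · simp [hT, disjoint_left.1 h hT]
      · by_cases hW : i ∈ W <;> simp [hT, hW]
    rw [prod_congr rfl fun i _ => this i, prod_mul_distrib]
    simp
  rw [← hl, key, powerset_univ]
  refine sum_congr rfl fun S _ => ?_
  unfold weight hit
  split_ifs with hS
  · rw [mul_one]
    congr 1
    · rw [prod_congr rfl fun i hi => if_neg fun hW => disjoint_left.1 hS.2 hW hi, prod_const]
    · rw [prod_congr rfl (g := fun _ => 1 - p), prod_const, ← compl_eq_univ_sdiff]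
      intro i hi
      exact if_neg fun hT => (mem_sdiff.1 hi).2 (hS.1 hT)
  · rw [mul_zero, eq_comm, mul_eq_zero]
    rw [not_and_or, not_subset, not_disjoint_iff] at hS
    rcases hS with ⟨i, hiT, hiS⟩ | ⟨i, hiW, hiS⟩
    · exact Or.inr (prod_eq_zero (i := i) (by simp [hiS]) (if_pos hiT))
    · exact Or.inl (prod_eq_zero hiS (if_pos hiW))

lemma expect_hit_empty (T : Finset V) : expect p (hit T ∅) = p ^ #T := by
  rw [expect_hit (disjoint_empty_right T)]; simp

lemma expect_card_inter (X : Finset V) : expect p (fun S => (#(X ∩ S) : ℝ)) = p * #X := by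
  simp_rw [card_inter_eq_sum_hit, expect_sum, expect_hit_empty]
  simp [mul_comm]

lemma expect_adjCount_inter (U : Finset V) :
    expect p (fun S => (adjCount G (U ∩ S) (U ∩ S) : ℝ)) = p ^ 2 * adjCount G U U := by
  simp_rw [adjCount_inter_eq_sum_hit, expect_sum, expect_hit_empty]
  rw [adjCount, Nat.cast_sum, mul_sum]
  refine sum_congr rfl fun x _ => ?_
  rw [sum_congr rfl (g := fun _ => p ^ 2), sum_const, nsmul_eq_mul, mul_comm]
  intro y hy
  rw [card_pair (mem_nbr.1 hy).2.ne]

end Expect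

/-! ### Four-cycles in graphs of bounded maximum degree -/

/-- The labelled four-cycles in `U`. -/
noncomputable def fourCycles (G : SimpleGraph V) (U : Finset V) : Finset (V × V × V × V) :=
  {c ∈ U ×ˢ U ×ˢ U ×ˢ U | G.Adj c.1 c.2.1 ∧ G.Adj c.2.1 c.2.2.1 ∧ G.Adj c.2.2.1 c.2.2.2 ∧
    G.Adj c.2.2.2 c.1 ∧ c.1 ≠ c.2.2.1 ∧ c.2.1 ≠ c.2.2.2}

/-- The vertex set of a labelled four-cycle. -/
noncomputable def verts (c : V × V × V × V) : Finset V := {c.1, c.2.1, c.2.2.1, c.2.2.2}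

lemma card_verts {U : Finset V} {c : V × V × V × V} (hc : c ∈ fourCycles G U) :
    #(verts c) = 4 := by
  obtain ⟨x, y, z, w⟩ := c
  simp only [fourCycles, mem_filter] at hc
  obtain ⟨-, h1, h2, h3, h4, h5, h6⟩ := hc
  simp only [verts]
  rw [card_insert_of_notMem, card_insert_of_notMem, card_pair h3.ne]
  · simp [h2.ne, h6]
  · simp [h1.ne, h5, h4.ne']

lemma verts_subset {U : Finset V} {c : V × V × V × V} (hc : c ∈ fourCycles G U) :
    verts c ⊆ U := by
  simp only [fourCycles, mem_filter, mem_product] at hc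
  intro v hv
  simp only [verts, mem_insert, mem_singleton] at hv
  rcases hv with rfl | rfl | rfl | rfl <;> tauto

/-- A cycle xyzw is an edge xy together with an edge between w in N(x) and z in N(y).
Kővári–Sós–Turán leaves at most Δ²/Z choices of the latter for each of the at most `#U * Δ` ordered
edges xy. -/
lemma card_fourCycles_mul_le {s Δ Z : ℕ} (hs : 1 ≤ s) (hG : BicliqueFree G s) {U : Finset V}
    (hΔ : ∀ x ∈ U, #(nbr G x U) ≤ Δ) (hZ : Z ^ s * s ^ 2 ≤ Δ) :
    #(fourCycles G U) * Z ≤ #U * Δ ^ 3 := by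
  have h1 : #(fourCycles G U) ≤
      ∑ x ∈ U, ∑ y ∈ nbr G x U, adjCount G (nbr G x U) (nbr G y U) := by
    have : #(fourCycles G U) ≤ #(U.sigma fun x => (nbr G x U).sigma fun y =>
        (nbr G x U).sigma fun w => nbr G w (nbr G y U)) := by
      refine card_le_card_of_injOn (fun c => ⟨c.1, c.2.1, c.2.2.2, c.2.2.1⟩) ?_ ?_
      · rintro ⟨x, y, z, w⟩ hc
        simp only [fourCycles, coe_filter, mem_product, Set.mem_ofPred_eq] at hc
        simp only [coe_sigma, Set.mem_sigma_iff, mem_coe, mem_nbr]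
        obtain ⟨⟨hx, hy, hz, hw⟩, h1, h2, h3, h4, -, -⟩ := hc
        exact ⟨hx, ⟨hy, h1⟩, ⟨hw, h4.symm⟩, ⟨hz, h2⟩, h3.symm⟩
      · rintro ⟨x, y, z, w⟩ - ⟨x', y', z', w'⟩ - h
        simp only [Sigma.mk.injEq, heq_eq_eq] at h
        grind
    simpa only [card_sigma, adjCount] using this
  calc #(fourCycles G U) * Z
      ≤ (∑ x ∈ U, ∑ y ∈ nbr G x U, adjCount G (nbr G x U) (nbr G y U)) * Z := by gcongr
    _ = ∑ x ∈ U, ∑ y ∈ nbr G x U, adjCount G (nbr G x U) (nbr G y U) * Z := by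
        simp only [sum_mul]
    _ ≤ ∑ x ∈ U, ∑ y ∈ nbr G x U, Δ ^ 2 := by
        gcongr with x hx y hy
        exact adjCount_mul_le hs hG (hΔ x hx) (hΔ y (nbr_subset _ _ hy)) hZ
    _ ≤ ∑ x ∈ U, Δ * Δ ^ 2 := by
        gcongr with x hx
        rw [sum_const, smul_eq_mul]
        exact Nat.mul_le_mul_right _ (hΔ x hx)
    _ = #U * Δ ^ 3 := by rw [sum_const, smul_eq_mul]; ring

/-- Deleting one vertex from each four-cycle. -/
lemma hasSparseDense_of_fourCycles {k : ℕ} {Y : Finset V}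
    (h : k * #Y + 2 * ∑ c ∈ fourCycles G Y, #(nbr G c.1 Y) < adjCount G Y Y) :
    HasSparseDense G k := by
  -- Deleting the first vertex of each cycle costs at most twice its degree in ordered pairs, and
  -- the strict hypothesis leaves an edge, hence a vertex.
  set R := (fourCycles G Y).image fun c => c.1 with hR
  have hRY : R ⊆ Y := by
    intro x hx
    obtain ⟨c, hc, rfl⟩ := mem_image.1 hx
    exact verts_subset hc (by simp [verts])
  have h1 := adjCount_le_sdiff_add (G := G) hRY
  have h2 : adjCount G R Y ≤ ∑ c ∈ fourCycles G Y, #(nbr G c.1 Y) := by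
    rw [sum_comp (fun x => #(nbr G x Y)) (fun c : V × V × V × V => c.1)]
    refine sum_le_sum fun x hx => ?_
    rw [smul_eq_mul]
    refine Nat.le_mul_of_pos_left _ (card_pos.2 ?_)
    obtain ⟨c, hc, rfl⟩ := mem_image.1 hx
    exact ⟨c, by simp [hc]⟩
  have h3 : k * #(Y \ R) ≤ k * #Y := Nat.mul_le_mul_left _ (card_le_card sdiff_subset)
  refine ⟨Y \ R, ?_, ?_, by omega⟩
  · rw [nonempty_iff_ne_empty]
    intro h0
    rw [h0] at h1
    have : adjCount G (∅ : Finset V) ∅ = 0 := by simp [adjCount]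
    omega
  · intro x hx y hy z hz w hw h1 h2 h3 h4
    by_contra! hne
    refine (mem_sdiff.1 hx).2 (mem_image.2 ⟨(x, y, z, w), ?_, rfl⟩)
    simp only [mem_sdiff] at hx hy hz hw
    simp [fourCycles, hx.1, hy.1, hz.1, hw.1, h1, h2, h3, h4, hne.1, hne.2]

/-- A graph with few edge-pointed four-cycles has a dense induced subgraph without any. -/
lemma hasSparseDense_of_maxDegree [Fintype V] {k s q L : ℕ} (hs : 1 ≤ s) (hG : BicliqueFree G s)
    {U : Finset V} (hL : 1 ≤ L) (hU : U.Nonempty) (hq : (4 * (4 * (k + 2) * L) ^ 4) ^ s * s ^ 2 ≤ q)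
    (hΔ : ∀ x ∈ U, #(nbr G x U) ≤ q * L) (hE : q * #U ≤ 4 * adjCount G U U) :
    HasSparseDense G k := by
  set K := 4 * (k + 2) with hK
  set Z := 4 * (K * L) ^ 4 with hZdef
  have hZpos : 1 ≤ Z := by
    have : 0 < Z := by positivity
    omega
  have hKq : K ≤ q := by
    calc K ≤ K * L := Nat.le_mul_of_pos_right _ hL
      _ ≤ (K * L) ^ 4 := Nat.le_self_pow (by norm_num) _
      _ ≤ Z := by omega
      _ ≤ Z ^ s := Nat.le_self_pow (by omega) _
      _ ≤ Z ^ s * s ^ 2 := Nat.le_mul_of_pos_right _ (by positivity)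
      _ ≤ q := hq
  have hcyc := card_fourCycles_mul_le hs hG hΔ (hq.trans (Nat.le_mul_of_pos_right _ hL))
  have hKpos : (0 : ℝ) < K := by positivity
  have hqpos : (0 : ℝ) < q := hKpos.trans_le (by exact_mod_cast hKq)
  -- With this density the expected number of ordered edges is at least p(k+2)|U|, of which kp|U|
  -- pays for the sampled vertices and p|U| for the deletions. The 4 in `K` offsets the 4 in `hE`.
  set p : ℝ := K / q with hp
  have hp0 : 0 < p := by positivity
  have hp1 : p ≤ 1 := (div_le_one hqpos).2 (by exact_mod_cast hKq)
  have hpq : p * q = K := by rw [hp]; field_simp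
  -- A neighbour of the deleted vertex either lies on the cycle (at most 4 of them, probability p^4)
  -- or is a fifth vertex (probability p^5).
  have hloss : ∀ c ∈ fourCycles G U, ∑ u ∈ nbr G c.1 U, p ^ #(insert u (verts c)) ≤
      4 * p ^ 4 + (q * L) * p ^ 5 := by
    intro c hc
    have hcard := card_verts hc
    have hsplit : ∀ u, p ^ #(insert u (verts c)) ≤ (if u ∈ verts c then p ^ 4 else 0) + p ^ 5 := by
      intro u
      split_ifs with hu
      · rw [insert_eq_of_mem hu, hcard]
        linarith [pow_pos hp0 5]
      · rw [card_insert_of_notMem hu, hcard, zero_add]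
    refine (sum_le_sum fun u _ => hsplit u).trans ?_
    rw [sum_add_distrib, ← sum_filter, sum_const, sum_const, nsmul_eq_mul, nsmul_eq_mul]
    gcongr
    · have : #{u ∈ nbr G c.1 U | u ∈ verts c} ≤ #(verts c) :=
        card_le_card fun u hu => (mem_filter.1 hu).2
      exact_mod_cast this.trans hcard.le
    · exact_mod_cast hΔ c.1 (verts_subset hc (by simp [verts]))
  have hexp : 0 < expect p (fun S => (adjCount G (U ∩ S) (U ∩ S) : ℝ) -
      (k * #(U ∩ S) + 2 * ∑ c ∈ fourCycles G U, ∑ u ∈ nbr G c.1 U,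
        hit (insert u (verts c)) ∅ S)) := by
    rw [expect_sub, expect_add, expect_const_mul, expect_const_mul, expect_sum,
      expect_adjCount_inter, expect_card_inter]
    simp_rw [expect_sum, expect_hit_empty]
    have h1 : ∑ c ∈ fourCycles G U, ∑ u ∈ nbr G c.1 U, p ^ #(insert u (verts c)) ≤
        #(fourCycles G U) * (4 * p ^ 4 + (q * L) * p ^ 5) := by
      rw [← nsmul_eq_mul]
      exact sum_le_card_nsmul _ _ _ hloss
    have h2 : (#(fourCycles G U) : ℝ) * (4 * p ^ 4 + (q * L) * p ^ 5) * 2 ≤ p * #U := by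
      have hKL : (4 : ℝ) ≤ K * L := by
        have : 4 ≤ K * L := by
          calc 4 ≤ K := by omega
            _ ≤ K * L := Nat.le_mul_of_pos_right _ hL
        exact_mod_cast this
      have hc : (#(fourCycles G U) : ℝ) * Z ≤ #U * (q * L) ^ 3 := by exact_mod_cast hcyc
      have hZ' : (Z : ℝ) = 4 * (K * L) ^ 4 := by rw [hZdef]; push_cast; ring
      have hZ0 : (0 : ℝ) < Z := by exact_mod_cast hZpos
      refine le_of_mul_le_mul_right ?_ hZ0
      calc (#(fourCycles G U) : ℝ) * (4 * p ^ 4 + (q * L) * p ^ 5) * 2 * Z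
          = (#(fourCycles G U) * Z) * (p ^ 4 * (4 + (p * q) * L) * 2) := by ring
        _ ≤ (#U * (q * L) ^ 3) * (p ^ 4 * (4 + (p * q) * L) * 2) := by gcongr
        _ = p * #U * (2 * (((p * q) * L) ^ 3 * (4 + (p * q) * L))) := by ring
        _ ≤ p * #U * (2 * ((K * L) ^ 3 * (K * L + K * L))) := by rw [hpq]; gcongr
        _ = p * #U * Z := by rw [hZ']; ring
    have h3 : p * (#U * (k + 2)) ≤ p ^ 2 * adjCount G U U := by
      have : (q : ℝ) * #U ≤ 4 * adjCount G U U := by exact_mod_cast hE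
      calc p * (#U * (k + 2)) = p * #U * K / 4 := by rw [hK]; push_cast; ring
        _ = p ^ 2 * (q * #U) / 4 := by rw [← hpq]; ring
        _ ≤ p ^ 2 * (4 * adjCount G U U) / 4 := by gcongr
        _ = _ := by ring
    have h4 : 0 < p * #U := mul_pos hp0 (by exact_mod_cast hU.card_pos)
    linarith
  obtain ⟨S, hS⟩ := exists_pos_of_expect_pos hp0.le hp1 hexp
  refine hasSparseDense_of_fourCycles (k := k) (Y := U ∩ S) ?_
  have hle : ((∑ c ∈ fourCycles G (U ∩ S), #(nbr G c.1 (U ∩ S)) : ℕ) : ℝ) ≤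
      ∑ c ∈ fourCycles G U, ∑ u ∈ nbr G c.1 U, hit (insert u (verts c)) ∅ S := by
    have hsub : fourCycles G (U ∩ S) ⊆ fourCycles G U := by
      intro c
      simp only [fourCycles, mem_filter, mem_product, mem_inter]
      tauto
    rw [Nat.cast_sum]
    refine le_trans (sum_le_sum fun c hc => le_of_eq ?_)
      (sum_le_sum_of_subset_of_nonneg hsub fun c _ _ => sum_nonneg fun u _ => hit_nonneg _ _ _)
    rw [nbr_inter, card_inter_eq_sum_hit]
    have hcS : verts c ⊆ S := (verts_subset hc).trans inter_subset_right
    exact sum_congr rfl fun u _ => by simp [hit, insert_subset_iff, hcS]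
  have : ((k * #(U ∩ S) + 2 * ∑ c ∈ fourCycles G (U ∩ S), #(nbr G c.1 (U ∩ S)) : ℕ) : ℝ) <
      adjCount G (U ∩ S) (U ∩ S) := by
    push_cast at hle ⊢
    linarith
  exact_mod_cast this

/-! ### Degeneracy: orientations and independent sets -/

/-- A graph all of whose subgraphs are sparse has an orientation with small outdegrees. -/
lemma exists_orientation {q : ℕ} (U : Finset V)
    (hU : ∀ T ⊆ U, adjCount G T T ≤ 2 * q * #T) :
    ∃ out : V → Finset V, (∀ v, #(out v) ≤ 2 * q) ∧ (∀ u, ∀ v ∈ out u, G.Adj u v) ∧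
      ∀ u ∈ U, ∀ v ∈ U, G.Adj u v → v ∈ out u ∨ u ∈ out v := by
  induction U using Finset.strongInduction with
  | H U ih =>
    rcases U.eq_empty_or_nonempty with rfl | hne
    · exact ⟨fun _ => ∅, by simp, by simp, by simp⟩
    obtain ⟨x, hx, hdeg⟩ : ∃ x ∈ U, #(nbr G x U) ≤ 2 * q := by
      refine exists_le_of_sum_le hne ?_
      rw [sum_const, smul_eq_mul, mul_comm]
      exact hU U Subset.rfl
    obtain ⟨out, h1, h2, h3⟩ := ih (U.erase x) (erase_ssubset hx)
      fun T hT => hU T (hT.trans (erase_subset _ _))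
    -- All edges from the low-degree vertex `x` to the rest of `U` are directed out of `x`.
    refine ⟨Function.update out x (nbr G x U), fun v => ?_, fun u v => ?_,
      fun u hu v hv huv => ?_⟩
    · by_cases hv : v = x
      · subst hv; simpa using hdeg
      · simpa [hv] using h1 v
    · by_cases hu : u = x
      · subst hu; simp
      · simpa [hu] using h2 u v
    · by_cases hux : u = x
      · subst hux; simp [hv, huv]
      · by_cases hvx : v = x
        · subst hvx; simp [hu, huv.symm]
        · simpa [hux, hvx] using h3 u (mem_erase.2 ⟨hux, hu⟩) v (mem_erase.2 ⟨hvx, hv⟩) huv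

/-- A relation that is hereditarily sparse has a large independent set. -/
lemma exists_independent {α : Type*} {R : α → α → Prop} (hR : ∀ x y, R x y → R y x) {m : ℝ}
    (T : Finset α) (hT : ∀ T' ⊆ T, (∑ x ∈ T', (#{y ∈ T' | R x y} : ℝ)) ≤ m * #T') :
    ∃ I ⊆ T, (∀ x ∈ I, ∀ y ∈ I, x ≠ y → ¬ R x y) ∧ (#T : ℝ) ≤ (m + 1) * #I := by
  induction T using Finset.strongInduction with
  | H T ih =>
    rcases T.eq_empty_or_nonempty with rfl | hne
    · exact ⟨∅, by simp, by simp, by simp⟩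
    obtain ⟨x, hx, hdeg⟩ : ∃ x ∈ T, (#{y ∈ T | R x y} : ℝ) ≤ m := by
      refine exists_le_of_sum_le hne ?_
      rw [sum_const, nsmul_eq_mul, mul_comm]
      exact hT T Subset.rfl
    set T' := {y ∈ T | y ≠ x ∧ ¬ R x y} with hT'
    have hT'T : T' ⊆ T := filter_subset _ _
    have hss : T' ⊂ T := (ssubset_iff_of_subset hT'T).2 ⟨x, hx, by simp [hT']⟩
    obtain ⟨I, hI, hind, hcard⟩ := ih T' hss fun T'' h => hT T'' (h.trans hT'T)
    have hxI : x ∉ I := fun h => by simpa [hT'] using hI h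
    refine ⟨insert x I, insert_subset hx (hI.trans hT'T), ?_, ?_⟩
    · intro y hy z hz hyz
      rcases mem_insert.1 hy with rfl | hy <;> rcases mem_insert.1 hz with rfl | hz
      · exact absurd rfl hyz
      · exact (mem_filter.1 (hI hz)).2.2
      · exact fun h => (mem_filter.1 (hI ‹y ∈ I›)).2.2 (hR _ _ h)
      · exact hind y hy z hz hyz
    · have hcov : T ⊆ T' ∪ insert x {y ∈ T | R x y} := by
        intro y hy
        simp only [hT', mem_union, mem_filter, mem_insert]
        tauto
      have h1 : #T ≤ #T' + (#{y ∈ T | R x y} + 1) :=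
        (card_le_card hcov).trans ((card_union_le _ _).trans
          (Nat.add_le_add_left (card_insert_le _ _) _))
      have h2 : (#T : ℝ) ≤ #T' + (#{y ∈ T | R x y} + 1) := by exact_mod_cast h1
      rw [card_insert_of_notMem hxI]
      push_cast
      linarith

/-! ### Sampling in an unbalanced pair -/

/-- The `k`-element subsets of `X` without related pairs of distinct elements. -/
noncomputable def freeSets {α : Type*} (R : α → α → Prop) (k : ℕ) (X : Finset α) :
    Finset (Finset α) :=
  {T ∈ X.powersetCard k | ∀ u ∈ T, ∀ v ∈ T, u ≠ v → ¬ R u v}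

lemma mem_freeSets {α : Type*} {R : α → α → Prop} {k : ℕ} {X T : Finset α} :
    T ∈ freeSets R k X ↔ T ⊆ X ∧ #T = k ∧ ∀ u ∈ T, ∀ v ∈ T, u ≠ v → ¬ R u v := by
  simp only [freeSets, mem_filter, mem_powersetCard, and_assoc]

/-- By the hypothesis and a union bound over positions, at most half of the k-tuples repeat an entry
or contain a related pair. A given k-set is the image of at most k^k tuples. -/
lemma card_pow_le_card_freeSets {α : Type*} {R : α → α → Prop} {k : ℕ} (hk : 2 ≤ k)
    {X : Finset α} (hX : 2 * k ^ 2 * (#X + ∑ u ∈ X, #{v ∈ X | u ≠ v ∧ R u v}) ≤ #X ^ 2) :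
    #X ^ k ≤ 2 * k ^ k * #(freeSets R k X) := by
  set E := ∑ u ∈ X, #{v ∈ X | u = v ∨ R u v} with hE
  have hEle : E ≤ #X + ∑ u ∈ X, #{v ∈ X | u ≠ v ∧ R u v} := by
    rw [card_eq_sum_ones, ← sum_add_distrib]
    refine sum_le_sum fun u hu => ?_
    have : ({v ∈ X | u = v ∨ R u v} : Finset α) ⊆ {u} ∪ {v ∈ X | u ≠ v ∧ R u v} := by
      intro v
      simp only [mem_filter, mem_union, mem_singleton]
      grind
    exact (card_le_card this).trans ((card_union_le _ _).trans (by simp))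
  set P := Fintype.piFinset fun _ : Fin k => X with hP
  have hPcard : #P = #X ^ k := by simp [hP, Fintype.card_piFinset]
  set bad := {f ∈ P | ∃ i j, i ≠ j ∧ (f i = f j ∨ R (f i) (f j))} with hbad
  have h1 : #bad ≤ k * (k - 1) * (E * #X ^ (k - 2)) :=
    by convert card_tuples_exists_rel_le k X fun u v => u = v ∨ R u v
  have h2 : 2 * #bad ≤ #X ^ k := by
    calc 2 * #bad ≤ 2 * (k * k * (E * #X ^ (k - 2))) := by
          refine Nat.mul_le_mul_left _ (h1.trans ?_)
          gcongr
          omega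
      _ = 2 * k ^ 2 * E * #X ^ (k - 2) := by ring
      _ ≤ #X ^ 2 * #X ^ (k - 2) := by
          gcongr
          exact (Nat.mul_le_mul_left _ hEle).trans hX
      _ = #X ^ k := by rw [← pow_add]; congr 1; omega
  set good := {f ∈ P | ¬ ∃ i j, i ≠ j ∧ (f i = f j ∨ R (f i) (f j))} with hgood
  have h3 : #bad + #good = #X ^ k := by
    rw [← hPcard]; exact card_filter_add_card_filter_not _
  have hinj : ∀ f ∈ good, Function.Injective f := by
    intro f hf i j hij
    by_contra hne
    exact (mem_filter.1 hf).2 ⟨i, j, hne, Or.inl hij⟩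
  have h4 : #good ≤ k ^ k * #(good.image fun f => univ.image f) := by
    refine card_le_mul_card_image _ _ fun T hT => ?_
    obtain ⟨f, hf, rfl⟩ := mem_image.1 hT
    have hTc : #(univ.image f) = k := by
      rw [card_image_of_injective _ (hinj f hf)]; simp
    have : ({g ∈ good | univ.image g = univ.image f} : Finset _) ⊆
        Fintype.piFinset fun _ : Fin k => univ.image f := by
      intro g hg
      rw [Fintype.mem_piFinset]
      intro i
      rw [← (mem_filter.1 hg).2]
      exact mem_image_of_mem _ (mem_univ i)
    refine (card_le_card this).trans ?_
    rw [Fintype.card_piFinset, prod_const, hTc, card_univ, Fintype.card_fin]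
  have h5 : good.image (fun f => univ.image f) ⊆ freeSets R k X := by
    intro T hT
    obtain ⟨f, hf, rfl⟩ := mem_image.1 hT
    have hfP := Fintype.mem_piFinset.1 (mem_filter.1 hf).1
    refine mem_freeSets.2 ⟨?_, ?_, ?_⟩
    · intro x hx
      obtain ⟨i, -, rfl⟩ := mem_image.1 hx
      exact hfP i
    · rw [card_image_of_injective _ (hinj f hf)]; simp
    · intro u hu v hv huv hR
      obtain ⟨i, -, rfl⟩ := mem_image.1 hu
      obtain ⟨j, -, rfl⟩ := mem_image.1 hv
      exact (mem_filter.1 hf).2 ⟨i, j, fun h => huv (by rw [h]), Or.inr hR⟩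
  have h6 := h4.trans (Nat.mul_le_mul_left _ (card_le_card h5))
  calc #X ^ k ≤ 2 * #good := by omega
    _ ≤ 2 * (k ^ k * #(freeSets R k X)) := by omega
    _ = _ := by ring

/-- For x = 1/q ≤ 1/2, log(1 - x) ≥ -2x, so (1 - 1/q)^q ≥ e^{-2} ≥ 1/9. -/
lemma one_sub_inv_pow_ge {q : ℕ} (hq : 2 ≤ q) (n : ℕ) :
    (1 / 9 : ℝ) ^ n ≤ (1 - 1 / (q : ℝ)) ^ (q * n) := by
  rw [pow_mul]
  gcongr
  have hq' : (2 : ℝ) ≤ q := by exact_mod_cast hq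
  have hpos : (0 : ℝ) < 1 - 1 / q := by
    rw [sub_pos, div_lt_one (by linarith)]; linarith
  have hlog : -(2 / (q : ℝ)) ≤ Real.log (1 - 1 / q) := by
    refine le_trans ?_ (Real.one_sub_inv_le_log_of_pos hpos)
    have : (1 - (1 : ℝ) / q)⁻¹ ≤ 1 + 2 / q := by
      rw [inv_le_iff_one_le_mul₀ hpos]
      have h0 : (0 : ℝ) < q := by linarith
      have : (1 + 2 / (q : ℝ)) * (1 - 1 / q) = 1 + (q - 2) / q ^ 2 := by field_simp; ring
      rw [this]
      have : 0 ≤ ((q : ℝ) - 2) / q ^ 2 := div_nonneg (by linarith) (by positivity)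
      linarith
    linarith
  have h1 : Real.exp (-2) ≤ (1 - 1 / (q : ℝ)) ^ q := by
    rw [← Real.exp_log hpos, ← Real.exp_nat_mul, Real.exp_le_exp]
    calc (-2 : ℝ) = q * -(2 / q) := by field_simp
      _ ≤ _ := by gcongr
  refine le_trans ?_ h1
  rw [Real.exp_neg, one_div]
  gcongr
  have h3 : Real.exp 1 < 3 := Real.exp_one_lt_three
  calc Real.exp 2 = Real.exp 1 * Real.exp 1 := by rw [← Real.exp_add]; norm_num
    _ ≤ 3 * 3 := by gcongr
    _ = 9 := by norm_num

/-- The event that the random set `S` meets `X` in a `k`-set without related or adjacent pairs,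
all of whose out-neighbours are missed. -/
def Clean (G : SimpleGraph V) (bad : V → V → Prop) (out : V → Finset V) (k : ℕ)
    (X S : Finset V) : Prop :=
  X ∩ S ∈ freeSets (fun u v => bad u v ∨ G.Adj u v) k X ∧ ∀ u ∈ X ∩ S, Disjoint (out u) S

/-- Adds up `F` exclusive events, one per free set. Since `x` is at least q/E, the powers of `q`
cancel and the bound does not depend on `q`. -/
lemma inv_le_mul_of_pow_le {k q E x F : ℕ} (hk : k ≠ 0) (hq : 0 < q) (hE : q ≤ E * x)
    (h : x ^ k ≤ 2 * k ^ k * F) (n : ℕ) :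
    1 / ((2 * k ^ k * E ^ k * 9 ^ n : ℕ) : ℝ) ≤ F * ((1 / (q : ℝ)) ^ k * (1 / 9 : ℝ) ^ n) := by
  have hE0 : 0 < E := Nat.pos_of_ne_zero fun h0 => by simp [h0] at hE; omega
  have hmain : q ^ k ≤ 2 * k ^ k * E ^ k * F := by
    calc q ^ k ≤ (E * x) ^ k := by gcongr
      _ = E ^ k * x ^ k := mul_pow ..
      _ ≤ E ^ k * (2 * k ^ k * F) := by gcongr
      _ = _ := by ring
  have hmain' : (q : ℝ) ^ k ≤ 2 * k ^ k * E ^ k * F := by exact_mod_cast hmain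
  have hkpos : (0 : ℝ) < k := by positivity
  push_cast
  rw [div_pow, div_pow, one_pow, one_pow, div_le_iff₀ (by positivity)]
  calc (1 : ℝ) = q ^ k * (1 / q ^ k) := by field_simp
    _ ≤ (2 * k ^ k * E ^ k * F) * (1 / q ^ k) := by gcongr
    _ = F * (1 / q ^ k * (1 / 9 ^ n)) * (2 * k ^ k * E ^ k * 9 ^ n) := by field_simp

/-- Each event forces `X ∩ S = T`, so the events are mutually exclusive, and each implies `Clean`.
-/
lemma sum_hit_le_clean (bad : V → V → Prop) (out : V → Finset V) (k : ℕ) (X S : Finset V) :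
    ∑ T ∈ freeSets (fun u v => bad u v ∨ G.Adj u v) k X, hit T (X \ T ∪ T.biUnion out) S ≤
      if Clean G bad out k X S then 1 else 0 := by
  set F := freeSets (fun u v => bad u v ∨ G.Adj u v) k X with hF
  have hTS : ∀ T ∈ F, hit T (X \ T ∪ T.biUnion out) S ≤
      if T = X ∩ S then (if Clean G bad out k X S then 1 else 0) else 0 := by
    intro T hT
    unfold hit
    have hTX : T ⊆ X := (mem_freeSets.1 hT).1
    by_cases h : T ⊆ S ∧ Disjoint (X \ T ∪ T.biUnion out) S
    · obtain ⟨h1, h2⟩ := h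
      rw [disjoint_union_left] at h2
      have hTeq : T = X ∩ S := by
        refine Subset.antisymm (subset_inter hTX h1) fun x hx => ?_
        by_contra hxT
        rw [mem_inter] at hx
        exact disjoint_left.1 h2.1 (mem_sdiff.2 ⟨hx.1, hxT⟩) hx.2
      have hclean : Clean G bad out k X S := by
        refine ⟨hTeq ▸ hT, fun u hu => ?_⟩
        rw [← hTeq] at hu
        exact disjoint_of_subset_left (subset_biUnion_of_mem out hu) h2.2
      rw [if_pos hTeq, if_pos hclean]
      split_ifs <;> simp
    · rw [if_neg h]
      split_ifs <;> simp
  refine (sum_le_sum hTS).trans ?_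
  rw [sum_ite_eq']
  split_ifs <;> simp

/-- A lower bound for the probability of `Clean`. -/
lemma inv_le_expect_clean [Fintype V] {bad : V → V → Prop} {out : V → Finset V} {k q E : ℕ}
    (hk : 2 ≤ k) (hq : 2 ≤ q) (hout : ∀ v, #(out v) ≤ 2 * q)
    (hadj : ∀ u, ∀ v ∈ out u, G.Adj u v)
    {X : Finset V} (hX4 : #X ≤ 4 * q) (hXE : q ≤ E * #X)
    (hX : 2 * k ^ 2 * (#X + ∑ u ∈ X, #{v ∈ X | u ≠ v ∧ (bad u v ∨ G.Adj u v)}) ≤ #X ^ 2) :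
    1 / ((2 * k ^ k * E ^ k * 9 ^ (2 * k + 4) : ℕ) : ℝ) ≤
      expect (1 / (q : ℝ)) (fun S => if Clean G bad out k X S then 1 else 0) := by
  set F := freeSets (fun u v => bad u v ∨ G.Adj u v) k X with hF
  set p : ℝ := 1 / q with hp
  have hq' : (2 : ℝ) ≤ q := by exact_mod_cast hq
  have hp0 : 0 ≤ p := by positivity
  have hp1 : p ≤ 1 := by rw [hp, div_le_one (by linarith)]; linarith
  have hlow : expect p (fun S => ∑ T ∈ F, hit T (X \ T ∪ T.biUnion out) S) ≤
      expect p (fun S => if Clean G bad out k X S then 1 else 0) :=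
    expect_mono hp0 hp1 fun S => sum_hit_le_clean bad out k X S
  refine le_trans ?_ hlow
  rw [expect_sum]
  have hterm : ∀ T ∈ F, p ^ k * (1 / 9 : ℝ) ^ (2 * k + 4) ≤
      expect p (hit T (X \ T ∪ T.biUnion out)) := by
    intro T hT
    obtain ⟨-, hTk, hTfree⟩ := mem_freeSets.1 hT
    -- Free sets span no edge, so no out-neighbour to be missed lies in `T` itself.
    have hdisj : Disjoint T (X \ T ∪ T.biUnion out) := by
      rw [disjoint_union_right]
      refine ⟨disjoint_sdiff, ?_⟩
      rw [disjoint_biUnion_right]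
      intro u hu
      rw [disjoint_left]
      intro v hv hvu
      have huv := hadj u v hvu
      exact hTfree u hu v hv huv.ne (Or.inr huv)
    have hcard : #(X \ T ∪ T.biUnion out) ≤ q * (2 * k + 4) := by
      refine (card_union_le _ _).trans ?_
      have h1 : #(X \ T) ≤ 4 * q := (card_le_card sdiff_subset).trans hX4
      have h2 : #(T.biUnion out) ≤ k * (2 * q) := by
        rw [← hTk]
        exact card_biUnion_le_card_mul _ _ _ fun u _ => hout u
      calc _ ≤ 4 * q + k * (2 * q) := by omega
        _ = _ := by ring
    rw [expect_hit hdisj, hTk]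
    gcongr
    refine (one_sub_inv_pow_ge hq _).trans ?_
    exact pow_le_pow_of_le_one (sub_nonneg.2 hp1) (by linarith) hcard
  have hcount : #X ^ k ≤ 2 * k ^ k * #F :=
    card_pow_le_card_freeSets hk (by convert hX using 9)
  refine (inv_le_mul_of_pow_le (by omega) (by omega) hXE hcount (2 * k + 4)).trans ?_
  rw [← nsmul_eq_mul]
  exact card_nsmul_le_sum _ _ _ hterm

/-- Sampling: if the pairs of large codegree are sparse in most neighbourhoods then a random
subset of `B` gives a dense induced subgraph without four-cycles. -/
lemma hasSparseDense_of_clean [Fintype V] {bad : V → V → Prop} {k q E : ℕ} {D : ℝ}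
    (hk : 2 ≤ k) (hq : 2 ≤ q) (hD : 0 ≤ D) {U A B : Finset V} (hAU : A ⊆ U) (hBU : B ⊆ U)
    (hAB : Disjoint A B)
    (hU : ∀ T ⊆ U, adjCount G T T ≤ 2 * q * #T)
    (hA4 : ∀ a ∈ A, #(nbr G a B) ≤ 4 * q) (hAE : ∀ a ∈ A, q ≤ E * #(nbr G a B))
    (hA : ∀ a ∈ A, 2 * k ^ 2 * (#(nbr G a B) + ∑ u ∈ nbr G a B,
      #{v ∈ nbr G a B | u ≠ v ∧ (bad u v ∨ G.Adj u v)}) ≤ #(nbr G a B) ^ 2)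
    (hbad : ∀ u ∈ B, ∀ v ∈ B, u ≠ v → ¬ bad u v → (#{a ∈ A | G.Adj a u ∧ G.Adj a v} : ℝ) ≤ D)
    (hcard : #B * ((2 * k ^ k * E ^ k * 9 ^ (2 * k + 4) : ℕ) : ℝ) * (2 * q + k ^ 2 * D + 1) <
      q * #A) : HasSparseDense G k := by
  obtain ⟨out, hout, hadj, hor⟩ := exists_orientation U hU
  set P : ℝ := ((2 * k ^ k * E ^ k * 9 ^ (2 * k + 4) : ℕ) : ℝ) with hP
  set m : ℝ := 2 * q + k ^ 2 * D with hm
  have hm0 : 0 ≤ m := by positivity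
  have hq' : (2 : ℝ) ≤ q := by exact_mod_cast hq
  have hqpos : (0 : ℝ) < q := by linarith
  have hA0 : 0 < #A := by
    rcases Nat.eq_zero_or_pos #A with h | h
    · rw [h] at hcard
      have : (0 : ℝ) ≤ #B * P * (m + 1) := by positivity
      simp at hcard
      linarith
    · exact h
  have hPpos : 0 < P := by
    obtain ⟨a, ha⟩ := card_pos.1 hA0
    have : E ≠ 0 := by
      rintro rfl
      have := hAE a ha
      omega
    rw [hP]
    positivity
  -- The surviving vertices of `A` must outnumber the sample by the factor `m + 1` that is lost in
  -- extracting an independent set from the conflict relation.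
  have hexp : 0 < expect (1 / (q : ℝ)) (fun S =>
      (∑ a ∈ A, if Clean G bad out k (nbr G a B) S then (1 : ℝ) else 0) -
        (m + 1) * #(B ∩ S)) := by
    rw [expect_sub, expect_sum, expect_const_mul, expect_card_inter]
    have h1 : #A * (1 / P) ≤ ∑ a ∈ A, expect (1 / (q : ℝ)) (fun S =>
        if Clean G bad out k (nbr G a B) S then (1 : ℝ) else 0) := by
      rw [← nsmul_eq_mul]
      exact card_nsmul_le_sum _ _ _ fun a ha =>
        inv_le_expect_clean hk hq hout hadj (hA4 a ha) (hAE a ha) (hA a ha)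
    have h2 : (m + 1) * (1 / q * #B) < #A * (1 / P) := by
      rw [mul_one_div, lt_div_iff₀ hPpos]
      calc (m + 1) * (1 / q * #B) * P = (#B * P * (m + 1)) / q := by ring
        _ < #A := by rw [div_lt_iff₀ hqpos]; linarith
    linarith
  obtain ⟨S, hS⟩ := exists_pos_of_expect_pos (by positivity)
    (by rw [div_le_one hqpos]; linarith) hexp
  rw [sum_boole] at hS
  set A' := {a ∈ A | Clean G bad out k (nbr G a B) S} with hA'
  -- Every edge is oriented some way, so `B'` is independent; by cleanness no vertex of `A'` loses a
  -- sampled neighbour here.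
  set B' := {u ∈ B ∩ S | Disjoint (out u) S} with hB'
  have hB'S : B' ⊆ B ∩ S := filter_subset _ _
  have hnbr : ∀ a ∈ A', nbr G a B' = nbr G a B ∩ S := by
    intro a ha
    have hcl := (mem_filter.1 ha).2.2
    ext u
    simp only [mem_nbr, hB', mem_filter, mem_inter] at hcl ⊢
    have := hcl u
    tauto
  have hfree : ∀ a ∈ A', nbr G a B' ∈ freeSets (fun u v => bad u v ∨ G.Adj u v) k (nbr G a B) :=
    fun a ha => hnbr a ha ▸ (mem_filter.1 ha).2.1
  have hkcard : ∀ a ∈ A', #(nbr G a B') = k :=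
    fun a ha => (mem_freeSets.1 (hfree a ha)).2.1
  set R : V → V → Prop := fun a a' => G.Adj a a' ∨ (a ≠ a' ∧ 2 ≤ #(nbr G a B' ∩ nbr G a' B'))
    with hR
  -- Fewer than k² ordered pairs of neighbours of `a` are available to be shared, none of them bad,
  -- so each has at most `D` common neighbours in `A`.
  have hconf : ∀ a ∈ A', (#{a' ∈ A' | 2 ≤ #(nbr G a B' ∩ nbr G a' B')} : ℝ) ≤ k ^ 2 * D := by
    intro a ha
    have hsub : ({a' ∈ A' | 2 ≤ #(nbr G a B' ∩ nbr G a' B')} : Finset V) ⊆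
        (nbr G a B').offDiag.biUnion fun uv => {a' ∈ A | G.Adj a' uv.1 ∧ G.Adj a' uv.2} := by
      intro a' ha'
      rw [mem_filter] at ha'
      obtain ⟨u, hu, v, hv, huv⟩ := one_lt_card.1 (show 1 < #(nbr G a B' ∩ nbr G a' B') from ha'.2)
      simp only [mem_inter, mem_nbr] at hu hv
      simp only [mem_biUnion, mem_offDiag, mem_filter]
      exact ⟨(u, v), ⟨by simp [hu.1], by simp [hv.1], huv⟩, (mem_filter.1 ha'.1).1, hu.2.2, hv.2.2⟩
    have h1 := (card_le_card hsub).trans card_biUnion_le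
    have h2 : (#{a' ∈ A' | 2 ≤ #(nbr G a B' ∩ nbr G a' B')} : ℝ) ≤
        ∑ uv ∈ (nbr G a B').offDiag, (#{a' ∈ A | G.Adj a' uv.1 ∧ G.Adj a' uv.2} : ℝ) := by
      exact_mod_cast h1
    refine h2.trans ?_
    have h3 : ∀ uv ∈ (nbr G a B').offDiag, (#{a' ∈ A | G.Adj a' uv.1 ∧ G.Adj a' uv.2} : ℝ) ≤ D := by
      intro uv huv
      rw [mem_offDiag] at huv
      have hB1 : ∀ w ∈ nbr G a B', w ∈ B := fun w hw =>
        (mem_inter.1 (hB'S (mem_nbr.1 hw).1)).1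
      refine hbad _ (hB1 _ huv.1) _ (hB1 _ huv.2.1) huv.2.2 fun hb => ?_
      exact (mem_freeSets.1 (hfree a ha)).2.2 _ huv.1 _ huv.2.1 huv.2.2 (Or.inl hb)
    refine (sum_le_card_nsmul _ _ _ h3).trans ?_
    rw [nsmul_eq_mul, offDiag_card, hkcard a ha]
    gcongr
    have : k * k - k ≤ k ^ 2 := by rw [sq]; exact Nat.sub_le _ _
    exact_mod_cast this
  obtain ⟨I, hIA', hind, hIcard⟩ := exists_independent (R := R) (m := m)
    (by
      rintro x y (h | ⟨h1, h2⟩)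
      · exact Or.inl h.symm
      · exact Or.inr ⟨h1.symm, by rwa [inter_comm]⟩) A' (by
      intro T' hT'
      have hTU : T' ⊆ U := hT'.trans ((filter_subset _ _).trans hAU)
      have h1 : ∀ x ∈ T', (#{y ∈ T' | R x y} : ℝ) ≤ #(nbr G x T') + k ^ 2 * D := by
        intro x hx
        have hs : ({y ∈ T' | R x y} : Finset V) ⊆
            nbr G x T' ∪ {a' ∈ A' | 2 ≤ #(nbr G x B' ∩ nbr G a' B')} := by
          intro y hy
          simp only [mem_filter, hR, mem_union, mem_nbr] at hy ⊢
          rcases hy.2 with h | h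
          · exact Or.inl ⟨hy.1, h⟩
          · exact Or.inr ⟨hT' hy.1, h.2⟩
        have h2 : (#{y ∈ T' | R x y} : ℝ) ≤ #(nbr G x T') +
            #{a' ∈ A' | 2 ≤ #(nbr G x B' ∩ nbr G a' B')} := by
          exact_mod_cast (card_le_card hs).trans (card_union_le _ _)
        exact h2.trans (by gcongr; exact hconf x (hT' hx))
      refine le_trans (sum_le_sum fun x hx => le_trans (le_of_eq (by congr!)) (h1 x hx)) ?_
      rw [sum_add_distrib, sum_const, nsmul_eq_mul, ← Nat.cast_sum, hm, add_mul]
      have : (adjCount G T' T' : ℝ) ≤ 2 * q * #T' := by exact_mod_cast hU T' hTU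
      have h3 : ((∑ x ∈ T', #(nbr G x T') : ℕ) : ℝ) ≤ 2 * q * #T' := this
      linarith)
  have hIA : I ⊆ A := hIA'.trans (filter_subset _ _)
  have hB'B : B' ⊆ B := hB'S.trans inter_subset_left
  have hIB : Disjoint I B' := disjoint_of_subset_left hIA (disjoint_of_subset_right hB'B hAB)
  have hlt : (m + 1) * (#B' : ℝ) < (m + 1) * #I := by
    have : (#B' : ℝ) ≤ #(B ∩ S) := by exact_mod_cast card_le_card hB'S
    have := mul_le_mul_of_nonneg_left this (show 0 ≤ m + 1 by linarith)
    linarith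
  have hlt' : #B' < #I := by exact_mod_cast lt_of_mul_lt_mul_left hlt (by linarith)
  have hIind : ∀ x ∈ I, ∀ y ∈ I, ¬ G.Adj x y := fun x hx y hy h =>
    hind x hx y hy h.ne (Or.inl h)
  have hBind : ∀ x ∈ B', ∀ y ∈ B', ¬ G.Adj x y := by
    intro x hx y hy h
    have hx' := mem_filter.1 hx
    have hy' := mem_filter.1 hy
    rcases hor x (hBU (hB'B hx)) y (hBU (hB'B hy)) h with h1 | h1
    · exact disjoint_left.1 hx'.2 h1 (mem_inter.1 hy'.1).2
    · exact disjoint_left.1 hy'.2 h1 (mem_inter.1 hx'.1).2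
  have hIshare : ∀ x ∈ I, ∀ z ∈ I, ∀ y ∈ B', ∀ w ∈ B', G.Adj x y → G.Adj z y → G.Adj x w →
      G.Adj z w → x = z ∨ y = w := by
    intro x hx z hz y hy w hw h1 h2 h3 h4
    by_contra! hne
    refine hind x hx z hz hne.1 (Or.inr ⟨hne.1, ?_⟩)
    exact one_lt_card.2 ⟨y, by simp [hy, h1, h2], w, by simp [hw, h3, h4], hne.2⟩
  refine ⟨I ∪ B', (card_pos.1 (by omega)).mono subset_union_left, ?_, ?_⟩
  · intro x hx y hy z hz w hw h1 h2 h3 h4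
    rw [mem_union] at hx hy hz hw
    rcases hx with hx | hx
    · have hy := hy.resolve_left fun h => hIind _ hx _ h h1
      have hw := hw.resolve_left fun h => hIind _ h _ hx h4
      have hz := hz.resolve_right fun h => hBind _ hy _ h h2
      exact hIshare x hx z hz y hy w hw h1 h2.symm h4.symm h3
    · have hy := hy.resolve_right fun h => hBind _ hx _ h h1
      have hw := hw.resolve_right fun h => hBind _ h _ hx h4
      have hz := hz.resolve_left fun h => hIind _ hy _ h h2
      exact (hIshare y hy w hw x hx z hz h1.symm h4 h2 h3.symm).symm
  -- The 2k|I| ordered edges suffice because |B'| < |I|.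
  · have h1 : adjCount G I B' = k * #I := by
      rw [adjCount, sum_congr rfl fun a ha => hkcard a (hIA' ha), sum_const, smul_eq_mul, mul_comm]
    rw [adjCount_union_self hIB, card_union_of_disjoint hIB, h1]
    have : k * #B' ≤ k * #I := Nat.mul_le_mul_left _ hlt'.le
    rw [mul_add]
    omega

/-! ### Dense pairs and the growth of a biclique -/

/-- A dense unbalanced bipartite pair `(A, B)` in `U`, all vertices of `A` having between `d` and
`4 * q` neighbours in `B`, together with `i` further vertices adjacent to all of `A`. -/
def DensePair (G : SimpleGraph V) (U : Finset V) (q i : ℕ) (d D : ℝ) : Prop :=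
  ∃ A B J : Finset V, A ⊆ U ∧ B ⊆ U ∧ Disjoint A B ∧ #J = i ∧ Disjoint J B ∧
    (∀ u ∈ J, ∀ a ∈ A, G.Adj u a) ∧ (∀ a ∈ A, d ≤ #(nbr G a B)) ∧
    (∀ a ∈ A, #(nbr G a B) ≤ 4 * q) ∧ D * #B ≤ adjCount G A B ∧ 0 < adjCount G A B

lemma DensePair.false_of_bicliqueFree {U : Finset V} {q s : ℕ} {d D : ℝ}
    (h : DensePair G U q s d D) (hG : BicliqueFree G s) (hD : s ≤ D) : False := by
  obtain ⟨A, B, J, -, -, -, hJ, -, hJA, -, -, hDe, hpos⟩ := h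
  have hle := adjCount_le_card_mul (G := G) A B
  have hB : 0 < #B := Nat.pos_of_ne_zero fun h0 => by rw [h0] at hle; omega
  have hB' : (0 : ℝ) < #B := by exact_mod_cast hB
  have h1 : D * #B ≤ #A * #B := hDe.trans (by exact_mod_cast hle)
  have h2 : (s : ℝ) ≤ #A := hD.trans (le_of_mul_le_mul_right h1 hB')
  obtain ⟨A', hA', hcard⟩ := exists_subset_card_eq (show s ≤ #A by exact_mod_cast h2)
  obtain ⟨x, hx, y, hy, hxy⟩ := hG J A' hJ hcard
  exact hxy (hJA x hx y (hA' hy))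

lemma sum_nbr_comm {M : Type*} [AddCommMonoid M] (A B : Finset V) (f : V → V → M) :
    ∑ u ∈ B, ∑ a ∈ nbr G u A, f u a = ∑ a ∈ A, ∑ u ∈ nbr G a B, f u a :=
  sum_comm' fun u a => by simp only [mem_nbr, G.adj_comm]; tauto

/-- Either the pairs of large codegree are rare, so that sampling applies, or one may pass to the
neighbourhood of a vertex and the vertices of large codegree with it. -/
lemma DensePair.step [Fintype V] {U : Finset V} {k s q i E : ℕ} {d D : ℝ} (hk : 2 ≤ k)
    (hs : 1 ≤ s) (hq : 2 ≤ q) (hG : BicliqueFree G s)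
    (hU : ∀ T ⊆ U, adjCount G T T ≤ 2 * q * #T) (h : DensePair G U q i d D)
    (hE : (q : ℝ) ≤ E * d) (hd : ((8 * k ^ 2) ^ s * s ^ 2 : ℝ) ≤ d) {P : ℝ}
    (hP : P = ((2 * k ^ k * E ^ k * 9 ^ (2 * k + 4) : ℕ) : ℝ)) (hD : 96 * q * P ≤ D) :
    HasSparseDense G k ∨
      DensePair G U q (i + 1) (d / (16 * k ^ 2)) (D / (64 * k ^ 2 * P)) := by
  obtain ⟨A, B, J, hAU, hBU, hAB, hJ, hJB, hJA, hAd, hA4, hDe, hpos⟩ := h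
  have hk' : (2 : ℝ) ≤ k := by exact_mod_cast hk
  have hk0 : (0 : ℝ) < k := by linarith
  have hq' : (2 : ℝ) ≤ q := by exact_mod_cast hq
  have hs' : (1 : ℝ) ≤ s := by exact_mod_cast hs
  have hd0 : 0 < d := lt_of_lt_of_le (by positivity) hd
  have hE0 : (0 : ℝ) < E := by
    by_contra! h0
    have : (E : ℝ) * d ≤ 0 := mul_nonpos_of_nonpos_of_nonneg h0 hd0.le
    linarith
  have hP0 : 0 < P := by rw [hP]; push_cast; positivity
  have hD0 : 0 < D := lt_of_lt_of_le (by positivity) hD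
  set d' : ℝ := d / (16 * k ^ 2) with hd'
  set D' : ℝ := D / (32 * k ^ 2 * P) with hD'
  have hd'0 : 0 < d' := by positivity
  have hD'0 : 0 < D' := by positivity
  set bad : V → V → Prop := fun u v => D' < #{a ∈ A | G.Adj a u ∧ G.Adj a v} with hbad
  set Γ : V → Finset V := fun u => {v ∈ B | u ≠ v ∧ bad u v} with hΓ
  by_cases hcase : ∃ u ∈ B, (nbr G u A).Nonempty ∧
      2 * d' * #(nbr G u A) ≤ adjCount G (nbr G u A) (Γ u)
  · right
    obtain ⟨u, huB, hne, hu⟩ := hcase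
    have hNA : nbr G u A ⊆ A := nbr_subset _ _
    have hΓB : Γ u ⊆ B := filter_subset _ _
    -- Vertices below the threshold `d'` carry at most half of the edges to `Γ u`; this halving
    -- turns the 32 in `D'` into 64.
    set A' := {a ∈ nbr G u A | d' ≤ #(nbr G a (Γ u))} with hA'
    have hA'N : A' ⊆ nbr G u A := filter_subset _ _
    have hsplit : (adjCount G (nbr G u A) (Γ u) : ℝ) ≤
        adjCount G A' (Γ u) + d' * #(nbr G u A) := by
      have h1 : adjCount G (nbr G u A) (Γ u) =
          adjCount G A' (Γ u) + adjCount G (nbr G u A \ A') (Γ u) := by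
        rw [← adjCount_union_left disjoint_sdiff, union_sdiff_of_subset hA'N]
      have h2 : (adjCount G (nbr G u A \ A') (Γ u) : ℝ) ≤ #(nbr G u A \ A') * d' := by
        rw [adjCount, Nat.cast_sum, ← nsmul_eq_mul]
        refine sum_le_card_nsmul _ _ _ fun a ha => ?_
        rw [mem_sdiff, hA', mem_filter, not_and, not_le] at ha
        exact (ha.2 ha.1).le
      have h3 : (#(nbr G u A \ A') : ℝ) ≤ #(nbr G u A) := by
        exact_mod_cast card_le_card sdiff_subset
      rw [h1]
      push_cast
      nlinarith
    have hcodeg : D' * #(Γ u) ≤ adjCount G (nbr G u A) (Γ u) := by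
      rw [adjCount_comm, adjCount, Nat.cast_sum, mul_comm, ← nsmul_eq_mul]
      refine card_nsmul_le_sum _ _ _ fun v hv => ?_
      have hb : bad u v := (mem_filter.1 hv).2.2
      refine le_of_lt (lt_of_lt_of_le hb ?_)
      gcongr
      intro a ha
      simp only [mem_filter, mem_nbr] at ha ⊢
      exact ⟨⟨ha.1, ha.2.1.symm⟩, ha.2.2.symm⟩
    have hcardN : (0 : ℝ) < #(nbr G u A) := by exact_mod_cast hne.card_pos
    refine ⟨A', Γ u, insert u J, (hA'N.trans hNA).trans hAU, hΓB.trans hBU,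
      disjoint_of_subset_left (hA'N.trans hNA) (disjoint_of_subset_right hΓB hAB), ?_, ?_, ?_,
      fun a ha => (mem_filter.1 ha).2, ?_, ?_, ?_⟩
    · rw [card_insert_of_notMem, hJ]
      exact fun h => disjoint_left.1 hJB h huB
    · rw [disjoint_insert_left]
      exact ⟨by simp [hΓ], disjoint_of_subset_right hΓB hJB⟩
    · intro v hv a ha
      rcases mem_insert.1 hv with rfl | hv
      · exact (mem_nbr.1 (hA'N ha)).2
      · exact hJA v hv a (hNA (hA'N ha))
    · exact fun a ha => (card_le_card (nbr_mono a hΓB)).trans (hA4 a (hNA (hA'N ha)))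
    · have : D / (64 * k ^ 2 * P) = D' / 2 := by rw [hD']; field_simp; norm_num
      rw [this]
      linarith
    · have : (0 : ℝ) < adjCount G A' (Γ u) := by nlinarith
      exact_mod_cast this
  · left
    push Not at hcase
    set bd : V → ℝ := fun a => ∑ u ∈ nbr G a B, (#(nbr G a (Γ u)) : ℝ) with hbd
    have hsum : ∑ a ∈ A, bd a ≤ 2 * d' * adjCount G A B := by
      rw [← sum_nbr_comm, adjCount_comm, adjCount, Nat.cast_sum, mul_sum]
      refine sum_le_sum fun u hu => ?_
      rcases (nbr G u A).eq_empty_or_nonempty with h0 | hne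
      · simp [h0]
      · have := (hcase u hu hne).le
        rwa [adjCount, Nat.cast_sum] at this
    -- Markov's inequality, weighted by degree: the vertices with too many bad pairs carry at most
    -- half of the edges.
    set Ag := {a ∈ A | bd a ≤ 4 * d' * #(nbr G a B)} with hAg
    have hAgA : Ag ⊆ A := filter_subset _ _
    have hgood : (adjCount G A B : ℝ) ≤ 2 * adjCount G Ag B := by
      have h1 : adjCount G A B = adjCount G Ag B + adjCount G (A \ Ag) B := by
        rw [← adjCount_union_left disjoint_sdiff, union_sdiff_of_subset hAgA]
      have h2 : 4 * d' * adjCount G (A \ Ag) B ≤ ∑ a ∈ A, bd a := by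
        rw [adjCount, Nat.cast_sum, mul_sum]
        refine (sum_le_sum fun a ha => ?_).trans
          (sum_le_sum_of_subset_of_nonneg sdiff_subset fun a _ _ =>
            sum_nonneg fun _ _ => Nat.cast_nonneg _)
        rw [mem_sdiff, hAg, mem_filter, not_and, not_le] at ha
        exact (ha.2 ha.1).le
      have h3 : d' * (4 * adjCount G (A \ Ag) B) ≤ d' * (2 * adjCount G A B) := by linarith
      have h4 := le_of_mul_le_mul_left h3 hd'0
      rw [h1] at h4 ⊢
      push_cast at h4 ⊢
      linarith
    have hAgcard : (adjCount G Ag B : ℝ) ≤ #Ag * (4 * q) := by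
      have : adjCount G Ag B ≤ #Ag * (4 * q) := by
        rw [← smul_eq_mul]
        exact sum_le_card_nsmul _ _ _ fun a ha => hA4 a (hAgA ha)
      exact_mod_cast this
    have hB : (0 : ℝ) < #B := by
      have hle := adjCount_le_card_mul (G := G) A B
      have : 0 < #B := Nat.pos_of_ne_zero fun h0 => by rw [h0] at hle; omega
      exact_mod_cast this
    refine hasSparseDense_of_clean (bad := bad) (E := E) (D := D') hk hq hD'0.le
      (hAgA.trans hAU) hBU (disjoint_of_subset_left hAgA hAB) hU
      (fun a ha => hA4 a (hAgA ha)) (fun a ha => ?_) (fun a ha => ?_) ?_ ?_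
    · have : (q : ℝ) ≤ E * #(nbr G a B) :=
        hE.trans (mul_le_mul_of_nonneg_left (hAd a (hAgA ha)) hE0.le)
      exact_mod_cast this
    · set X := nbr G a B with hX
      set m := #X with hm
      have hdm : d ≤ m := hAd a (hAgA ha)
      have hmZ : (8 * k ^ 2) ^ s * s ^ 2 ≤ m := by exact_mod_cast hd.trans hdm
      have hm8 : 8 * k ^ 2 ≤ m := by
        calc 8 * k ^ 2 ≤ (8 * k ^ 2) ^ s := Nat.le_self_pow (by omega) _
          _ ≤ (8 * k ^ 2) ^ s * s ^ 2 := Nat.le_mul_of_pos_right _ (by positivity)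
          _ ≤ m := hmZ
      have he := adjCount_mul_le hs hG (X := X) (Y := X) le_rfl le_rfl hmZ
      have hbda : bd a ≤ 4 * d' * m := (mem_filter.1 ha).2
      have hle : ((∑ u ∈ X, #{v ∈ X | u ≠ v ∧ (bad u v ∨ G.Adj u v)} : ℕ) : ℝ) ≤
          bd a + adjCount G X X := by
        rw [hbd, adjCount, Nat.cast_sum, Nat.cast_sum, ← sum_add_distrib]
        refine sum_le_sum fun u _ => ?_
        rw [← Nat.cast_add, Nat.cast_le]
        refine le_trans (card_le_card ?_) (card_union_le _ _)
        intro v hv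
        simp only [hX, hΓ, mem_filter, mem_union, mem_nbr] at hv ⊢
        tauto
      have hm8' : (8 * k ^ 2 : ℝ) * m ≤ m ^ 2 := by
        have : (8 * k ^ 2 : ℝ) ≤ m := by exact_mod_cast hm8
        rw [sq (m : ℝ)]
        gcongr
      have he' : (adjCount G X X : ℝ) * (8 * k ^ 2) ≤ m ^ 2 := by exact_mod_cast he
      have hd16 : d' * (16 * k ^ 2) = d := by rw [hd']; field_simp
      have hbda' : 4 * k ^ 2 * bd a ≤ m ^ 2 := by
        calc 4 * k ^ 2 * bd a ≤ 4 * k ^ 2 * (4 * d' * m) := by gcongr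
          _ = (d' * (16 * k ^ 2)) * m := by ring
          _ ≤ m * m := by rw [hd16]; gcongr
          _ = m ^ 2 := by ring
      -- The budget m² is split as 1/4 for the diagonal, 1/2 for bad pairs and 1/4 for adjacent
      -- pairs, the last by Kővári–Sós–Turán.
      have hfin : (2 * k ^ 2 : ℝ) * (m + (∑ u ∈ X, #{v ∈ X | u ≠ v ∧ (bad u v ∨ G.Adj u v)} : ℕ)) ≤
          m ^ 2 := by
        calc _ ≤ (2 * k ^ 2 : ℝ) * (m + (bd a + adjCount G X X)) := by gcongr
          _ ≤ _ := by linarith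
      exact_mod_cast hfin
    · intro u _ v _ _ hnb
      refine le_trans ?_ (not_lt.1 hnb)
      gcongr
    · rw [← hP]
      have hk2D : k ^ 2 * D' * P = D / 32 := by rw [hD']; field_simp
      have h1 : P * (2 * q + k ^ 2 * D' + 1) < D / 8 := by nlinarith
      calc #B * P * (2 * q + k ^ 2 * D' + 1) = #B * (P * (2 * q + k ^ 2 * D' + 1)) := by ring
        _ < #B * (D / 8) := by gcongr
        _ ≤ q * #Ag := by linarith

/-- If sampling never applies, `s` steps produce `s` vertices complete to a set of size at least
`s`. The hypotheses build in the total loss of all steps, so that one `E` and one `P` serve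
throughout. -/
lemma hasSparseDense_of_densePair [Fintype V] {U : Finset V} {k s q E : ℕ} {d D : ℝ} (hk : 2 ≤ k)
    (hs : 1 ≤ s) (hq : 2 ≤ q) (hsq : s ≤ q) (hG : BicliqueFree G s)
    (hU : ∀ T ⊆ U, adjCount G T T ≤ 2 * q * #T) (h : DensePair G U q 0 d D) (hE1 : 1 ≤ E)
    (hE : (q : ℝ) * (16 * k ^ 2) ^ s ≤ E * d)
    (hd : ((8 * k ^ 2) ^ s * s ^ 2 : ℝ) * (16 * k ^ 2) ^ s ≤ d) {P : ℝ}
    (hP : P = ((2 * k ^ k * E ^ k * 9 ^ (2 * k + 4) : ℕ) : ℝ))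
    (hD : 96 * q * P * (64 * k ^ 2 * P) ^ s ≤ D) : HasSparseDense G k := by
  have hk' : (2 : ℝ) ≤ k := by exact_mod_cast hk
  have hP1 : 1 ≤ P := by
    rw [hP, Nat.one_le_cast, Nat.one_le_iff_ne_zero]
    positivity
  have ha : (1 : ℝ) ≤ 16 * k ^ 2 := by nlinarith
  have hb : (1 : ℝ) ≤ 64 * k ^ 2 * P := by nlinarith
  have key : ∀ i ≤ s, HasSparseDense G k ∨
      DensePair G U q i (d / (16 * k ^ 2) ^ i) (D / (64 * k ^ 2 * P) ^ i) := by
    intro i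
    induction i with
    | zero => intro _; right; simpa using h
    | succ i ih =>
      intro hi
      rcases ih (by omega) with h' | h'
      · exact Or.inl h'
      have hai : (0 : ℝ) < (16 * k ^ 2) ^ i := by positivity
      have hbi : (0 : ℝ) < (64 * k ^ 2 * P) ^ i := by positivity
      have hai' : (16 * k ^ 2 : ℝ) ^ i ≤ (16 * k ^ 2) ^ s := pow_le_pow_right₀ ha (by omega)
      have hbi' : (64 * k ^ 2 * P : ℝ) ^ i ≤ (64 * k ^ 2 * P) ^ s := pow_le_pow_right₀ hb (by omega)
      have hstep := h'.step (E := E) hk hs hq hG hU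
        (by
          rw [← mul_div_assoc, le_div_iff₀ hai]
          exact le_trans (by gcongr) hE)
        (by
          rw [le_div_iff₀ hai]
          exact le_trans (by gcongr) hd) hP
        (by
          rw [le_div_iff₀ hbi]
          exact le_trans (by gcongr) hD)
      rwa [div_div, div_div, ← pow_succ, ← pow_succ] at hstep
  rcases key s le_rfl with h' | h'
  · exact h'
  · refine (h'.false_of_bicliqueFree hG ?_).elim
    rw [le_div_iff₀ (by positivity)]
    refine le_trans ?_ hD
    gcongr
    have : (s : ℝ) ≤ q := by exact_mod_cast hsq
    nlinarith

/-! ### Reduction to bounded degree or a dense pair -/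

/-- Splitting off the vertices of large degree leaves either a dense graph of bounded maximum
degree or a dense unbalanced bipartite pair. -/
lemma exists_dense_or_densePair {U : Finset V} {q L : ℕ} (hq : 1 ≤ q) (hL : 64 ≤ L)
    (hne : U.Nonempty) (hU : ∀ T ⊆ U, adjCount G T T ≤ 2 * q * #T)
    (hE : q * #U ≤ adjCount G U U) :
    (∃ A ⊆ U, A.Nonempty ∧ (∀ x ∈ A, #(nbr G x A) ≤ q * L) ∧ q * #A ≤ 4 * adjCount G A A) ∨
      DensePair G U q 0 (q / 8) (q * L / 32) := by
  have hn : 0 < q * #U := Nat.mul_pos hq hne.card_pos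
  set H := {v ∈ U | q * L ≤ #(nbr G v U)} with hH
  have hHU : H ⊆ U := filter_subset _ _
  set A := U \ H with hA
  have hAU : A ⊆ U := sdiff_subset
  have hAH : Disjoint A H := sdiff_disjoint
  have hqA : q * #A ≤ q * #U := Nat.mul_le_mul_left _ (card_le_card hAU)
  have hHL : #H * L ≤ 2 * #U := by
    have h1 : #H * (q * L) ≤ adjCount G H U := by
      rw [← smul_eq_mul]
      exact card_nsmul_le_sum _ _ _ fun v hv => (mem_filter.1 hv).2
    have h2 : adjCount G H U ≤ 2 * q * #U := (adjCount_mono hHU Subset.rfl).trans (hU U Subset.rfl)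
    refine Nat.le_of_mul_le_mul_left ?_ hq
    calc q * (#H * L) = #H * (q * L) := by ring
      _ ≤ 2 * q * #U := h1.trans h2
      _ = _ := by ring
  have hH32 : 32 * #H ≤ #U := by
    have : #H * 64 ≤ #H * L := Nat.mul_le_mul_left _ hL
    omega
  have hqH : 32 * (q * #H) ≤ q * #U := by
    calc 32 * (q * #H) = q * (32 * #H) := by ring
      _ ≤ _ := Nat.mul_le_mul_left _ hH32
  by_cases hcase : q * #U ≤ 4 * adjCount G A A
  · left
    refine ⟨A, hAU, ?_, fun x hx => ?_, hqA.trans hcase⟩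
    · rw [nonempty_iff_ne_empty]
      intro h0
      have : adjCount G A A = 0 := by rw [h0]; simp [adjCount]
      omega
    · rw [hA, mem_sdiff, hH, mem_filter, not_and, not_le] at hx
      exact (card_le_card (nbr_mono x hAU)).trans (hx.2 hx.1).le
  · right
    have hsum : adjCount G U U = adjCount G A A + 2 * adjCount G A H + adjCount G H H := by
      rw [← adjCount_union_self hAH, hA, sdiff_union_of_subset hHU]
    have hHH : adjCount G H H ≤ 2 * (q * #H) := by
      rw [← mul_assoc]; exact hU H hHU
    have hAHe : q * #U ≤ 4 * adjCount G A H := by omega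
    set X := {a ∈ A | 4 * q < #(nbr G a H)} with hX
    set Y := {a ∈ A | 8 * #(nbr G a H) < q} with hY
    set A' := {a ∈ A | q ≤ 8 * #(nbr G a H) ∧ #(nbr G a H) ≤ 4 * q} with hA'
    have hXA : X ⊆ A := filter_subset _ _
    -- Each vertex of `X` sends more than 4q edges to `H`, while `X ∪ H` is sparse, so these edges
    -- are charged to `H`, which is small.
    have hXe : adjCount G X H ≤ 2 * (q * #H) := by
      have h1 : #X * (4 * q) ≤ adjCount G X H := by
        rw [← smul_eq_mul]
        exact card_nsmul_le_sum _ _ _ fun v hv => (mem_filter.1 hv).2.le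
      have hdisj : Disjoint X H := disjoint_of_subset_left hXA hAH
      have h2 := adjCount_union_self (G := G) hdisj
      have h3 := hU (X ∪ H) (union_subset (hXA.trans hAU) hHU)
      rw [card_union_of_disjoint hdisj] at h3
      have h4 : #X * (4 * q) = 4 * (q * #X) := by ring
      have h5 : 2 * q * (#X + #H) = 2 * (q * #X) + 2 * (q * #H) := by ring
      omega
    have hYe : 8 * adjCount G Y H ≤ q * #U := by
      have h1 : 8 * adjCount G Y H ≤ #Y * q := by
        rw [adjCount, mul_sum, ← smul_eq_mul (a := #Y)]
        exact sum_le_card_nsmul _ _ _ fun v hv => (mem_filter.1 hv).2.le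
      refine h1.trans ?_
      rw [mul_comm]
      exact Nat.mul_le_mul_left _ (card_le_card ((filter_subset _ _).trans hAU))
    have hcov : adjCount G A H ≤ adjCount G A' H + adjCount G X H + adjCount G Y H := by
      have h1 : A ⊆ A' ∪ X ∪ Y := by
        intro a ha
        simp only [hA', hX, hY, mem_union, mem_filter]
        simp only [ha, true_and]
        omega
      have h2 : ∀ S T : Finset V, adjCount G (S ∪ T) H ≤ adjCount G S H + adjCount G T H := by
        intro S T
        rw [adjCount, adjCount, adjCount, ← sum_union_inter]
        exact Nat.le_add_right _ _
      have h3 := adjCount_mono (G := G) h1 (Subset.refl H)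
      have h4 := h2 (A' ∪ X) Y
      have h5 := h2 A' X
      omega
    have hA'e : q * #U ≤ 16 * adjCount G A' H := by omega
    have hA'A : A' ⊆ A := filter_subset _ _
    refine ⟨A', H, ∅, hA'A.trans hAU, hHU, disjoint_of_subset_left hA'A hAH, rfl,
      disjoint_empty_left _, by simp, fun a ha => ?_, fun a ha => (mem_filter.1 ha).2.2, ?_, by omega⟩
    · have : (q : ℝ) ≤ 8 * #(nbr G a H) := by exact_mod_cast (mem_filter.1 ha).2.1
      linarith
    · have h1 : q * (#H * L) ≤ q * (2 * #U) := Nat.mul_le_mul_left _ hHL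
      have h2 : q * L * #H ≤ 32 * adjCount G A' H := by
        calc q * L * #H = q * (#H * L) := by ring
          _ ≤ q * (2 * #U) := h1
          _ = 2 * (q * #U) := by ring
          _ ≤ _ := by omega
      have h3 : (q : ℝ) * L * #H ≤ 32 * adjCount G A' H := by exact_mod_cast h2
      linarith

/-- An induced subgraph of maximum average degree. -/
lemma exists_maximal_density [Fintype V] [Nonempty V] {N : ℕ} (hN : 1 ≤ N)
    (h : N * Fintype.card V ≤ adjCount G univ univ) :
    ∃ (U : Finset V) (q : ℕ), U.Nonempty ∧ N ≤ q ∧ q * #U ≤ adjCount G U U ∧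
      ∀ T ⊆ U, adjCount G T T ≤ 2 * q * #T := by
  obtain ⟨U, hU, hmax⟩ := exists_max_image ({T | T.Nonempty} : Finset (Finset V))
    (fun T => (adjCount G T T : ℝ) / #T) ⟨univ, by simp⟩
  have hUne : U.Nonempty := by simpa using hU
  have hpos : (0 : ℝ) < #U := by exact_mod_cast hUne.card_pos
  set ρ : ℝ := (adjCount G U U : ℝ) / #U with hρ
  have hNρ : (N : ℝ) ≤ ρ := by
    refine le_trans ?_ (hmax univ (by simp))
    have : (0 : ℝ) < #(univ : Finset V) := by exact_mod_cast univ_nonempty.card_pos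
    rw [le_div_iff₀ this, card_univ]
    exact_mod_cast h
  have hρ0 : 0 ≤ ρ := (Nat.cast_nonneg N).trans hNρ
  have hNq : N ≤ ⌊ρ⌋₊ := Nat.le_floor hNρ
  refine ⟨U, ⌊ρ⌋₊, hUne, hNq, ?_, fun T _ => ?_⟩
  · have : (⌊ρ⌋₊ : ℝ) * #U ≤ adjCount G U U := by
      rw [← le_div_iff₀ hpos]; exact Nat.floor_le hρ0
    exact_mod_cast this
  · rcases T.eq_empty_or_nonempty with rfl | hT
    · simp [adjCount]
    · have hTpos : (0 : ℝ) < #T := by exact_mod_cast hT.card_pos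
      have h1 : (adjCount G T T : ℝ) / #T ≤ ρ := hmax T (by simpa using hT)
      rw [div_le_iff₀ hTpos] at h1
      -- Rounding the density down to `q` costs the factor 2, as ρ < q + 1 ≤ 2q.
      have h2 : ρ < ⌊ρ⌋₊ + 1 := Nat.lt_floor_add_one ρ
      have h3 : (1 : ℝ) ≤ ⌊ρ⌋₊ := by exact_mod_cast hN.trans hNq
      have : (adjCount G T T : ℝ) ≤ 2 * ⌊ρ⌋₊ * #T := by
        refine h1.trans ?_
        gcongr
        linarith
      exact_mod_cast this

/-! ### Explicit thresholds and their growth -/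

/-- The reciprocal of the success probability in the sampling step. -/
def sampleBound (k s : ℕ) : ℕ := 2 * k ^ k * (8 * (16 * k ^ 2) ^ s) ^ k * 9 ^ (2 * k + 4)

/-- The imbalance of the bipartite pairs in the proof. -/
def imbalance (k s : ℕ) : ℕ := 3072 * sampleBound k s * (64 * k ^ 2 * sampleBound k s) ^ s

/-- An average degree that forces a dense induced subgraph without four-cycles. -/
def degreeThreshold (k s : ℕ) : ℕ := (4 * (4 * (k + 2) * imbalance k s) ^ 4) ^ s * s ^ 2

lemma sampleBound_pos {k : ℕ} (hk : 0 < k) (s : ℕ) : 0 < sampleBound k s := by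
  unfold sampleBound; positivity

lemma imbalance_ge {k : ℕ} (hk : 0 < k) (s : ℕ) : 64 ≤ imbalance k s := by
  have := sampleBound_pos hk s
  have h : 0 < sampleBound k s * (64 * k ^ 2 * sampleBound k s) ^ s := by positivity
  unfold imbalance
  rw [mul_assoc]
  omega

lemma hasSparseDense_of_degreeThreshold_le [Fintype V] [Nonempty V] {k s N : ℕ} (hk : 2 ≤ k)
    (hs : 1 ≤ s) (hG : BicliqueFree G s) (hN : degreeThreshold k s ≤ N)
    (h : N * Fintype.card V ≤ adjCount G univ univ) : HasSparseDense G k := by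
  set L := imbalance k s with hL
  have hL64 : 64 ≤ L := imbalance_ge (by omega) s
  set Z := 4 * (4 * (k + 2) * L) ^ 4 with hZ
  have hZs : Z ^ s * s ^ 2 ≤ N := hN
  have hbase : 8 * (8 * k ^ 2 * (16 * k ^ 2)) ≤ Z := by
    calc 8 * (8 * k ^ 2 * (16 * k ^ 2)) = 4 * (4 * k * 1) ^ 4 := by ring
      _ ≤ Z := by rw [hZ]; gcongr <;> omega
  have hZN : Z ≤ N := (Nat.le_self_pow (by omega) _).trans
    ((Nat.le_mul_of_pos_right _ (by positivity)).trans hZs)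
  have hZ0 : 2 ≤ Z := by
    have : 0 < 8 * k ^ 2 * (16 * k ^ 2) := by positivity
    omega
  have hsN : s ≤ N := by
    have h1 : 0 < Z ^ s := by positivity
    calc s ≤ s ^ 2 := Nat.le_self_pow (by norm_num) _
      _ ≤ Z ^ s * s ^ 2 := Nat.le_mul_of_pos_left _ h1
      _ ≤ N := hZs
  obtain ⟨U, q, hne, hNq, hUE, hU⟩ := exists_maximal_density (by omega) h
  rcases exists_dense_or_densePair (by omega) hL64 hne hU hUE with ⟨A, -, hAne, hΔ, hA⟩ | hpair
  · exact hasSparseDense_of_maxDegree hs hG (by omega) hAne (hZs.trans hNq) hΔ hA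
  -- The pair starts with d = q/8 and D = qL/32: hence the 8 in `E`, and 3072 = 96 · 32 in
  -- `imbalance`.
  · refine hasSparseDense_of_densePair (E := 8 * (16 * k ^ 2) ^ s) hk hs (by omega)
      (hsN.trans hNq) hG hU hpair ?_ ?_ ?_ (P := (sampleBound k s : ℝ)) rfl ?_
    · have : 0 < 8 * (16 * k ^ 2) ^ s := by positivity
      omega
    · push_cast
      exact le_of_eq (by ring)
    · have h1 : 8 * ((8 * k ^ 2) ^ s * s ^ 2 * (16 * k ^ 2) ^ s) ≤ q := by
        calc 8 * ((8 * k ^ 2) ^ s * s ^ 2 * (16 * k ^ 2) ^ s)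
            = 8 * (8 * k ^ 2 * (16 * k ^ 2)) ^ s * s ^ 2 := by rw [mul_pow _ (16 * k ^ 2)]; ring
          _ ≤ 8 ^ s * (8 * k ^ 2 * (16 * k ^ 2)) ^ s * s ^ 2 := by
              gcongr; exact Nat.le_self_pow (by omega) _
          _ = (8 * (8 * k ^ 2 * (16 * k ^ 2))) ^ s * s ^ 2 := by rw [mul_pow 8]
          _ ≤ Z ^ s * s ^ 2 := by gcongr
          _ ≤ q := hZs.trans hNq
      have h2 : (8 : ℝ) * ((8 * k ^ 2) ^ s * s ^ 2 * (16 * k ^ 2) ^ s) ≤ q := by exact_mod_cast h1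
      linarith
    · have h1 : (L : ℝ) = 3072 * sampleBound k s * (64 * k ^ 2 * sampleBound k s) ^ s := by
        rw [hL, imbalance]; push_cast; ring
      rw [h1]
      exact le_of_eq (by ring)

lemma mul_pow_le_pow {a b s : ℕ} (hs : 1 ≤ s) : a * b ^ s ≤ (a * b) ^ s := by
  rw [mul_pow]
  gcongr
  exact Nat.le_self_pow (by omega) _

/-- The three quantities are bounded by c^s, w^{s²} and C^{s³} in turn; constant factors go into the
base since the exponents are positive. -/
lemma exists_degreeThreshold_le {k : ℕ} (hk : 0 < k) :
    ∃ C : ℕ, 2 ≤ C ∧ ∀ s : ℕ, 1 ≤ s → degreeThreshold k s ≤ C ^ s ^ 3 := by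
  set c := 2 * k ^ k * 9 ^ (2 * k + 4) * (128 * k ^ 2) ^ k with hc
  set w := (3072 * (64 * k ^ 2 * c)) ^ 2 with hw
  have hc0 : 0 < c := by positivity
  have hw0 : 0 < w := by positivity
  refine ⟨16 * (4 * (k + 2) * w) ^ 4, ?_, fun s hs => ?_⟩
  · have : 0 < (4 * (k + 2) * w) ^ 4 := by positivity
    omega
  have hP : sampleBound k s ≤ c ^ s := by
    calc sampleBound k s = 2 * k ^ k * 9 ^ (2 * k + 4) * (8 * (16 * k ^ 2) ^ s) ^ k := by
          unfold sampleBound; ring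
      _ ≤ 2 * k ^ k * 9 ^ (2 * k + 4) * ((8 * (16 * k ^ 2)) ^ s) ^ k := by
          gcongr; exact mul_pow_le_pow hs
      _ = 2 * k ^ k * 9 ^ (2 * k + 4) * ((128 * k ^ 2) ^ k) ^ s := by
          rw [← pow_mul, ← pow_mul, mul_comm s k]; ring
      _ ≤ c ^ s := mul_pow_le_pow hs
  have hP0 := sampleBound_pos hk s
  have hLw : imbalance k s ≤ w ^ s ^ 2 := by
    have h64 : 1 ≤ 64 * k ^ 2 := by
      have : 0 < 64 * k ^ 2 := by positivity
      omega
    calc imbalance k s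
        ≤ 3072 * (64 * k ^ 2 * sampleBound k s) * (64 * k ^ 2 * sampleBound k s) ^ s := by
          unfold imbalance
          gcongr
          exact Nat.le_mul_of_pos_left _ (by omega)
      _ = 3072 * (64 * k ^ 2 * sampleBound k s) ^ (s + 1) := by ring
      _ ≤ 3072 * (64 * k ^ 2 * c ^ s) ^ (s + 1) := by gcongr
      _ ≤ 3072 * ((64 * k ^ 2 * c) ^ s) ^ (s + 1) := by
          gcongr; exact mul_pow_le_pow hs
      _ = 3072 * (64 * k ^ 2 * c) ^ (s * (s + 1)) := by rw [pow_mul]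
      _ ≤ (3072 * (64 * k ^ 2 * c)) ^ (s * (s + 1)) := mul_pow_le_pow (by nlinarith)
      _ ≤ (3072 * (64 * k ^ 2 * c)) ^ (2 * s ^ 2) := by
          refine Nat.pow_le_pow_right (by positivity) ?_
          nlinarith
      _ = w ^ s ^ 2 := by rw [hw, ← pow_mul]
  have hs2 : 1 ≤ s ^ 2 := Nat.one_le_pow _ _ hs
  have hs24 : s ^ 2 ≤ 4 ^ s := by
    calc s ^ 2 ≤ (2 ^ s) ^ 2 := Nat.pow_le_pow_left Nat.lt_two_pow_self.le _
      _ = 4 ^ s := by rw [← pow_mul, mul_comm, pow_mul]; norm_num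
  calc degreeThreshold k s ≤ (4 * (4 * (k + 2) * w ^ s ^ 2) ^ 4) ^ s * 4 ^ s := by
        unfold degreeThreshold; gcongr
    _ = (16 * (4 * (k + 2) * w ^ s ^ 2) ^ 4) ^ s := by rw [← mul_pow]; ring
    _ ≤ (16 * ((4 * (k + 2) * w) ^ s ^ 2) ^ 4) ^ s := by
        gcongr; exact mul_pow_le_pow hs2
    _ = (16 * ((4 * (k + 2) * w) ^ 4) ^ s ^ 2) ^ s := by
        rw [← pow_mul, ← pow_mul, mul_comm (s ^ 2) 4]
    _ ≤ ((16 * (4 * (k + 2) * w) ^ 4) ^ s ^ 2) ^ s := by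
        gcongr; exact mul_pow_le_pow hs2
    _ = _ := by rw [← pow_mul]; congr 1

/-! ### Transfer to classes of graphs -/

lemma adjCount_map {V W : Type*} (G : SimpleGraph V) (f : W ↪ V) (X Y : Finset W) :
    adjCount G (X.map f) (Y.map f) = adjCount (G.comap f) X Y := by
  unfold adjCount nbr
  rw [sum_map]
  refine sum_congr rfl fun x _ => ?_
  rw [filter_map, card_map]
  rfl

lemma adjCount_univ {V : Type*} [Fintype V] (G : SimpleGraph V) :
    adjCount G univ univ = 2 * G.edgeSet.ncard := by
  rw [Set.ncard_eq_toFinset_card', ← SimpleGraph.edgeFinset, ← G.sum_degrees_eq_twice_card_edges]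
  refine sum_congr rfl fun x _ => ?_
  rw [nbr, ← SimpleGraph.card_neighborFinset_eq_degree]
  congr 1
  ext y
  simp

end DegreeBounded

namespace FinGraph

open DegreeBounded Finset

lemma averageDegree_eq (G : FinGraph.{u}) [Fintype G.V] :
    G.averageDegree = (adjCount G.graph univ univ : ℝ) / Fintype.card G.V := by
  rw [averageDegree, adjCount_univ, Nat.card_eq_fintype_card]
  push_cast
  rfl

/-- Completely joined sets are automatically disjoint because adjacency is irreflexive, so they give
an injective copy. -/
lemma bicliqueFree_of_not_containsBiclique {G : FinGraph.{u}} {s : ℕ}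
    (h : ¬ G.ContainsBiclique s) : BicliqueFree G.graph s := by
  intro X Y hX hY
  by_contra! hcon
  let eX := X.equivFinOfCardEq hX
  let eY := Y.equivFinOfCardEq hY
  have hadj : ∀ i j, G.graph.Adj (eX.symm i) (eY.symm j) := fun i j =>
    hcon _ (eX.symm i).2 _ (eY.symm j).2
  refine h ⟨⟨⟨Sum.elim (fun i => (eX.symm i : G.V)) fun j => (eY.symm j : G.V), ?_⟩, ?_⟩⟩
  · rintro (i | i) (j | j) hij
    · simp at hij
    · exact hadj i j
    · exact (hadj j i).symm
    · simp at hij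
  · rintro (i | i) (j | j) hij
    · exact congrArg Sum.inl (eX.symm.injective (Subtype.ext hij))
    · exact absurd hij (hadj i j).ne
    · exact absurd hij (hadj j i).ne'
    · exact congrArg Sum.inr (eY.symm.injective (Subtype.ext hij))

/-- A copy of K_{2,2} is a four-cycle. -/
lemma bicliqueNumber_induce_le_one {G : FinGraph.{u}} {S : Finset G.V}
    (hS : (S : Set G.V).Nonempty) (h : FourCycleFree G.graph S) :
    (G.induce S hS).bicliqueNumber ≤ 1 := by
  by_contra! ht
  obtain ⟨f⟩ := (G.induce S hS).isGreatest_bicliqueNumber.1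
  set t := (G.induce S hS).bicliqueNumber
  let i : Fin t := ⟨0, by omega⟩
  let j : Fin t := ⟨1, ht⟩
  have hij : i ≠ j := by simp [i, j]
  let φ : Fin t ⊕ Fin t → (S : Set G.V) := fun a => f a
  have hφ : Function.Injective fun a => (φ a : G.V) :=
    Subtype.val_injective.comp f.injective
  have hadj : ∀ a b : Fin t, G.graph.Adj (φ (Sum.inl a)) (φ (Sum.inr b)) := fun a b =>
    f.toHom.map_adj (v := Sum.inl a) (w := Sum.inr b) (by simp)
  rcases h _ (φ (Sum.inl i)).2 _ (φ (Sum.inr i)).2 _ (φ (Sum.inl j)).2 _ (φ (Sum.inr j)).2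
    (hadj i i) (hadj j i).symm (hadj j j) (hadj i j).symm with h' | h'
  · exact hij (Sum.inl_injective (hφ h'))
  · exact hij (Sum.inr_injective (hφ h'))

lemma le_averageDegree_induce {G : FinGraph.{u}} {S : Finset G.V}
    (hS : (S : Set G.V).Nonempty) {k : ℕ} (h : k * #S ≤ adjCount G.graph S S) :
    (k : ℝ) ≤ (G.induce S hS).averageDegree := by
  have : Fintype (G.induce S hS).V := inferInstanceAs (Fintype S)
  rw [averageDegree_eq, le_div_iff₀ (by exact_mod_cast Fintype.card_pos)]
  let f : (G.induce S hS).V ↪ G.V := Function.Embedding.subtype _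
  have hmap : (univ : Finset (G.induce S hS).V).map f = S := by
    ext x
    simp only [mem_map, mem_univ, true_and]
    exact ⟨fun ⟨y, hy⟩ => hy ▸ y.2, fun hx => ⟨⟨x, hx⟩, rfl⟩⟩
  have hcard : Fintype.card (G.induce S hS).V = #S := by
    conv_rhs => rw [← hmap]
    rw [card_map, card_univ]
  have hcount : adjCount (G.induce S hS).graph univ univ = adjCount G.graph S S := by
    conv_rhs => rw [← hmap]
    rw [adjCount_map]
    rfl
  rw [hcard, hcount]
  exact_mod_cast h

/-- The members of a hereditary degree-bounded family without a biclique of given size have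
bounded average degree. -/
lemma exists_forall_averageDegree_lt {F : Set FinGraph.{u}} (hF : IsHereditary F)
    (hb : IsDegreeBounded F) :
    ∃ C : ℕ, 2 ≤ C ∧
      ∀ G ∈ F, ∀ s : ℕ, ¬ G.ContainsBiclique s → G.averageDegree < (C : ℝ) ^ (s ^ 3) := by
  obtain ⟨g, hg⟩ := hb
  -- Exceeds both possible bounds, for biclique number 0 and 1, and is at least 2 as sampling
  -- requires.
  set k := g 0 + g 1 + 2 with hk
  obtain ⟨C, hC2, hC⟩ := exists_degreeThreshold_le (k := k) (by omega)
  refine ⟨C, hC2, fun G hG s hs => ?_⟩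
  by_contra! hdeg
  let _ := Fintype.ofFinite G.V
  have hfree := bicliqueFree_of_not_containsBiclique hs
  have hs1 : 1 ≤ s := by
    rcases Nat.eq_zero_or_pos s with rfl | h
    · obtain ⟨x, hx, -⟩ := hfree ∅ ∅ rfl rfl
      simp at hx
    · exact h
  rw [averageDegree_eq, le_div_iff₀ (by exact_mod_cast Fintype.card_pos)] at hdeg
  have hdeg' : C ^ s ^ 3 * Fintype.card G.V ≤ adjCount G.graph univ univ := by exact_mod_cast hdeg
  obtain ⟨S, hne, hcyc, hdense⟩ :=
    hasSparseDense_of_degreeThreshold_le (by omega) hs1 hfree (hC s hs1) hdeg'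
  have hS : (S : Set G.V).Nonempty := by exact_mod_cast hne
  have h1 := bicliqueNumber_induce_le_one hS hcyc
  have h2 := le_averageDegree_induce hS hdense
  have h3 := h2.trans (hg _ (hF G hG S hS))
  have h4 : k ≤ g (G.induce S hS).bicliqueNumber := by exact_mod_cast h3
  interval_cases h : (G.induce S hS).bicliqueNumber <;> omega

lemma averageDegree_eq_zero_of_not_containsBiclique_one {G : FinGraph.{u}}
    (h : ¬ G.ContainsBiclique 1) : G.averageDegree = 0 := by
  have hfree := bicliqueFree_of_not_containsBiclique h
  have hedge : G.graph.edgeSet = ∅ := by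
    rw [SimpleGraph.edgeSet_eq_empty]
    ext x y
    obtain ⟨x', hx, y', hy, hxy⟩ := hfree {x} {y} (card_singleton _) (card_singleton _)
    rw [mem_singleton] at hx hy
    subst hx hy
    simpa using hxy
  simp [averageDegree, hedge]

end FinGraph

theorem corollary1p4 (F : Set FinGraph.{u}) (hF : FinGraph.IsHereditary F)
    (hb : FinGraph.IsDegreeBounded F) :
    ∃ C : ℕ,
      FinGraph.IsDegreeBoundingFunction F (fun s => C ^ (s ^ 3)) ∧
      ∀ G ∈ F, ∀ s : ℕ, ¬ G.ContainsBiclique s → G.averageDegree < (C : ℝ) ^ (s ^ 3) := by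
  obtain ⟨C, hC2, hC⟩ := FinGraph.exists_forall_averageDegree_lt hF hb
  have hC1 : (1 : ℝ) ≤ C := by exact_mod_cast (by omega : 1 ≤ C)
  -- With t the biclique number, G has no K_{t+1,t+1}, and (t+1)³ ≤ 8t³ for t ≥ 1. For t = 0 there
  -- are no edges.
  refine ⟨C ^ 8, fun G hG => ?_, fun G hG s hs => (hC G hG s hs).trans_le ?_⟩
  · have hnot : ¬ G.ContainsBiclique (G.bicliqueNumber + 1) := fun h =>
      absurd (G.isGreatest_bicliqueNumber.2 h) (by omega)
    rcases Nat.eq_zero_or_pos G.bicliqueNumber with h0 | hpos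
    · rw [h0] at hnot
      rw [FinGraph.averageDegree_eq_zero_of_not_containsBiclique_one hnot]
      exact Nat.cast_nonneg _
    · refine (hC G hG _ hnot).le.trans ?_
      push_cast
      rw [← pow_mul]
      refine pow_le_pow_right₀ hC1 ?_
      calc (G.bicliqueNumber + 1) ^ 3 ≤ (2 * G.bicliqueNumber) ^ 3 := by gcongr; omega
        _ = 8 * G.bicliqueNumber ^ 3 := by ring
  · push_cast
    rw [← pow_mul]
    exact pow_le_pow_right₀ hC1 (by omega)
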